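/- Let $n\ge 2$ and let $O_n$ be the Cuntz algebra, i.e. the universal unital $C^*$-algebra generated by isometries $S_1,\dots,S_n$ with $\sum_i S_iS_i^*=1$. For a finite word $\mu=\mu_1\cdots\mu_k$ in $\{1,\dots,n\}$ put $S_\mu=S_{\mu_1}\cdots S_{\mu_k}$ and $|\mu|=k$ (with $S_\emptyset=1$), and let $O_{nc}=\mathrm{span}\{S_\mu S_\nu^*\}$. Let $\gamma$ be the gauge action of $\mathbb T$ on $O_n$, $\gamma_z(S_i)=zS_i$, let $F$ be its fixed point algebra, $\Phi(a)=\frac1{2\pi}\int_0^{2\pi}\gamma_{e^{i\theta}}(a)\,d\theta$ the expectation $O_n\to F$, and $\tau$ the (unique) faithful normalised trace on $F$. Let $\mathcal H=L^2(O_n)$ be the completion of $O_n$ for $\langle a,b\rangle=(\tau\circ\Phi)(a^*b)$, on which $O_n$ acts by left multiplication. Let $\mathcal D$ be the closure of the operator on $O_{nc}\subset\mathcal H$ given by $\mathcal D(S_\mu S_\nu^*)=(|\mu|-|\nu|)S_\mu S_\nu^*$. The antilinear operator $a\mapsto a^*$ on $O_{nc}\subset\mathcal H$ is closable. Let $S$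 be its closure and $\Delta=S^*S$. Then: 1. $S=J\Delta^{1/2}$ (with equality of domains) for an antilinear isometry $J$ of $\mathcal H$ with $J^2=1$. 2. For all finite words $\mu,\nu$, the vector $S_\mu S_\nu^*$ lies in the domain of $\Delta$ and $$\Delta\, S_\mu S_\nu^*=n^{|\nu|-|\mu|}S_\mu S_\nu^*.$$ 3. The modular automorphism group is given, for all $t\in\mathbb R$ and all finite words $\mu,\nu$, by $$\sigma_t(S_\mu S_\nu^*)=\Delta^{it}S_\mu S_\nu^*\Delta^{-it}=n^{it(|\nu|-|\mu|)}S_\mu S_\nu^*$$ as operators on $\mathcal H$. 4. $\mathcal D$ is self-adjoint and generates the gauge action: $e^{it\mathcal D}a=\gamma_{e^{it}}(a)$ for $a\in O_n\subset\mathcal H$ and $t\in\mathbb R$. Moreover $$\Delta=e^{-\mathcal D\log n}\qquad\text{and}\qquad e^{it\mathcal D}=e^{-\frac{it}{\log n}\log\Delta}\quad(t\in\mathbb R).$$ -/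

import Mathlib

open scoped ComplexOrder InnerProductSpace ComplexConjugate
open MeasureTheory Filter Topology

noncomputable section

/-! ## The Cuntz algebra, its gauge action and its KMS state -/

/-- A Cuntz family: `n` isometries in a unital C⋆-algebra whose range projections sum to `1`. -/
structure IsCuntzFamily {n : ℕ} {B : Type*} [CStarAlgebra B] (T : Fin n → B) : Prop where
  isometry : ∀ i, star (T i) * T i = 1
  sum_range : ∑ i, T i * star (T i) = 1

/-- `A`, with the generators `S 0, …, S (n - 1)`, is the Cuntz algebra `O_n`: the universal unital
C⋆-algebra generated by a Cuntz family. -/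
structure IsCuntzAlgebra.{u} {n : ℕ} {A : Type u} [CStarAlgebra A] (S : Fin n → A) : Prop where
  family : IsCuntzFamily S
  generates : (StarAlgebra.adjoin ℂ (Set.range S)).topologicalClosure = ⊤
  universal : ∀ (B : Type u) [CStarAlgebra B] (T : Fin n → B), IsCuntzFamily T →
    ∃ φ : A →⋆ₐ[ℂ] B, ∀ i, φ (S i) = T i

/-- `S_μ = S_{μ₁} ⋯ S_{μ_k}` for a finite word `μ`; the empty word gives `1`. -/
def cuntzWord {n : ℕ} {A : Type*} [CStarAlgebra A] (S : Fin n → A) (μ : List (Fin n)) : A :=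
  (μ.map S).prod

/-- The element `S_μ S_ν^*`. -/
def cuntzMonomial {n : ℕ} {A : Type*} [CStarAlgebra A] (S : Fin n → A) (μ ν : List (Fin n)) : A :=
  cuntzWord S μ * star (cuntzWord S ν)

/-- The dense subalgebra `O_{nc} = span {S_μ S_ν^*}` (as a linear subspace). -/
def cuntzCore {n : ℕ} {A : Type*} [CStarAlgebra A] (S : Fin n → A) : Submodule ℂ A :=
  Submodule.span ℂ {a | ∃ μ ν, a = cuntzMonomial S μ ν}

theorem star_mem_cuntzCore {n : ℕ} {A : Type*} [CStarAlgebra A] (S : Fin n → A) {a : A}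
    (ha : a ∈ cuntzCore S) : star a ∈ cuntzCore S := by
  induction ha using Submodule.span_induction with
  | mem x hx =>
    obtain ⟨μ, ν, rfl⟩ := hx
    exact Submodule.subset_span ⟨ν, μ, by simp [cuntzMonomial]⟩
  | zero => simp
  | add x y _ _ hx hy => rw [star_add]; exact add_mem hx hy
  | smul c x _ hx => rw [star_smul]; exact Submodule.smul_mem _ _ hx

namespace IsCuntzAlgebra

variable {n : ℕ} {A : Type*} [CStarAlgebra A] {S : Fin n → A}

theorem isCuntzFamily_smul (h : IsCuntzAlgebra S) (z : Circle) :
    IsCuntzFamily (fun i => (z : ℂ) • S i) := by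
  have hz : star (z : ℂ) * z = 1 := by
    rw [Complex.star_def, ← Circle.coe_inv_eq_conj, ← Circle.coe_mul]; simp
  constructor
  · intro i
    simp only [star_smul, smul_mul_smul_comm, hz, one_smul, h.family.isometry]
  · simp only [star_smul, smul_mul_smul_comm, mul_comm (z : ℂ), hz, one_smul, h.family.sum_range]

/-- The gauge action: `γ_z` is the endomorphism of `O_n` with `γ_z (S_i) = z S_i`, which exists by
the universal property. -/
def gauge (h : IsCuntzAlgebra S) (z : Circle) : A →⋆ₐ[ℂ] A :=
  (h.universal A _ (h.isCuntzFamily_smul z)).choose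

theorem gauge_apply (h : IsCuntzAlgebra S) (z : Circle) (i : Fin n) :
    h.gauge z (S i) = (z : ℂ) • S i :=
  (h.universal A _ (h.isCuntzFamily_smul z)).choose_spec i

theorem continuous_hom (φ : A →⋆ₐ[ℂ] A) : Continuous φ :=
  AddMonoidHomClass.continuous_of_bound φ 1 fun a => by
    simpa using NonUnitalStarAlgHom.norm_apply_le φ a

/-- Unital star homomorphisms are determined by their values on the generators. -/
theorem hom_ext (h : IsCuntzAlgebra S) {φ ψ : A →⋆ₐ[ℂ] A} (H : ∀ i, φ (S i) = ψ (S i)) :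
    φ = ψ := by
  have hφ : Continuous φ := continuous_hom φ
  have hψ : Continuous ψ := continuous_hom ψ
  ext a
  have ha : a ∈ (StarAlgebra.adjoin ℂ (Set.range S)).topologicalClosure := by
    rw [h.generates]; trivial
  have hcl : IsClosed {a | φ a = ψ a} := isClosed_eq hφ hψ
  refine closure_minimal (fun b hb => ?_) hcl ha
  induction hb using StarAlgebra.adjoin_induction with
  | mem x hx => obtain ⟨i, rfl⟩ := hx; exact H i
  | algebraMap r => simp [AlgHomClass.commutes]
  | add x y _ _ hx hy => simp only [Set.mem_ofPred_eq] at *; simp [hx, hy]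
  | mul x y _ _ hx hy => simp only [Set.mem_ofPred_eq] at *; simp [hx, hy]
  | star x _ hx => simp only [Set.mem_ofPred_eq] at *; simp [map_star, hx]

theorem gauge_mul (h : IsCuntzAlgebra S) (w z : Circle) (a : A) :
    h.gauge w (h.gauge z a) = h.gauge (w * z) a := by
  have : (h.gauge w).comp (h.gauge z) = h.gauge (w * z) := by
    refine h.hom_ext fun i => ?_
    simp [gauge_apply, map_smul, smul_smul, mul_comm]
  exact DFunLike.congr_fun this a

/-- The gauge action is strongly continuous. -/
theorem continuous_gauge (h : IsCuntzAlgebra S) (a : A) : Continuous fun z => h.gauge z a := by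
  have hcl : IsClosed {a | Continuous fun z => h.gauge z a} := by
    refine isClosed_of_closure_subset fun a ha => ?_
    rw [Metric.mem_closure_iff] at ha
    refine continuous_of_uniform_approx_of_continuous fun u hu => ?_
    obtain ⟨ε, hε, hu⟩ := Metric.mem_uniformity_dist.1 hu
    obtain ⟨b, hb, hab⟩ := ha ε hε
    refine ⟨_, hb, fun z => hu ?_⟩
    rw [dist_eq_norm, ← map_sub]
    refine (NonUnitalStarAlgHom.norm_apply_le (h.gauge z) _).trans_lt ?_
    rwa [← dist_eq_norm]
  have ha : a ∈ (StarAlgebra.adjoin ℂ (Set.range S)).topologicalClosure := by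
    rw [h.generates]; trivial
  refine closure_minimal (fun b hb => ?_) hcl ha
  induction hb using StarAlgebra.adjoin_induction with
  | mem x hx =>
    obtain ⟨i, rfl⟩ := hx
    simp only [Set.mem_ofPred_eq, gauge_apply]
    fun_prop
  | algebraMap r => simp only [Set.mem_ofPred_eq, AlgHomClass.commutes]; fun_prop
  | add x y _ _ hx hy => simp only [Set.mem_ofPred_eq, map_add] at *; exact hx.add hy
  | mul x y _ _ hx hy => simp only [Set.mem_ofPred_eq, map_mul] at *; exact hx.mul hy
  | star x _ hx => simp only [Set.mem_ofPred_eq, map_star] at *; exact hx.star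

/-- The fixed point algebra `F` of the gauge action. -/
def fixedPoints (h : IsCuntzAlgebra S) : StarSubalgebra ℂ A where
  carrier := {a | ∀ z, h.gauge z a = a}
  mul_mem' ha hb z := by rw [map_mul, ha z, hb z]
  add_mem' ha hb z := by rw [map_add, ha z, hb z]
  algebraMap_mem' r z := AlgHomClass.commutes _ r
  star_mem' ha z := by rw [map_star, ha z]

theorem intervalIntegrable_gauge (h : IsCuntzAlgebra S) (a : A) (s t : ℝ) :
    IntervalIntegrable (fun θ : ℝ => h.gauge (Circle.exp θ) a) volume s t :=
  ((h.continuous_gauge a).comp Circle.exp.continuous).intervalIntegrable _ _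

/-- `Φ(a) = (1 / 2π) ∫₀^{2π} γ_{exp(iθ)}(a) dθ`. -/
def average (h : IsCuntzAlgebra S) (a : A) : A :=
  ((2 * Real.pi)⁻¹ : ℝ) • ∫ θ in (0 : ℝ)..(2 * Real.pi), h.gauge (Circle.exp θ) a

theorem average_mem (h : IsCuntzAlgebra S) (a : A) : h.average a ∈ h.fixedPoints := by
  intro w
  obtain ⟨s, rfl⟩ := Circle.exp_surjective w
  have hc : Continuous (h.gauge (Circle.exp s)) := continuous_hom _
  let L : A →L[ℝ] A :=
    ⟨((h.gauge (Circle.exp s)).toAlgHom.toLinearMap).restrictScalars ℝ, hc⟩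
  have hL : ∀ x, h.gauge (Circle.exp s) x = L x := fun _ => rfl
  have hper : Function.Periodic (fun θ : ℝ => h.gauge (Circle.exp θ) a) (2 * Real.pi) := by
    intro θ; simp only [Circle.periodic_exp θ]
  unfold average
  rw [hL, map_smul, ← L.intervalIntegral_comp_comm (h.intervalIntegrable_gauge a _ _)]
  congr 1
  simp only [← hL, gauge_mul, ← Circle.exp_add]
  rw [intervalIntegral.integral_comp_add_left (fun θ : ℝ => h.gauge (Circle.exp θ) a) s]
  simpa using hper.intervalIntegral_add_eq s 0

/-- The conditional expectation `Φ : O_n → F`. -/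
def expectation (h : IsCuntzAlgebra S) : A →ₗ[ℂ] h.fixedPoints where
  toFun a := ⟨h.average a, h.average_mem a⟩
  map_add' a b := by
    apply Subtype.ext
    simp only [average, map_add, AddMemClass.mk_add_mk]
    rw [intervalIntegral.integral_add (h.intervalIntegrable_gauge a _ _)
      (h.intervalIntegrable_gauge b _ _), smul_add]
  map_smul' c a := by
    apply Subtype.ext
    simp only [average, map_smul, RingHom.id_apply, SetLike.val_smul]
    rw [intervalIntegral.integral_smul, smul_comm]

/-- `τ` is a faithful normalised trace on `F` (there is exactly one). -/
structure IsFaithfulNormalizedTrace (h : IsCuntzAlgebra S) (τ : h.fixedPoints →ₗ[ℂ] ℂ) :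
    Prop where
  map_one : τ 1 = 1
  nonneg : ∀ a, 0 ≤ τ (star a * a)
  trace : ∀ a b, τ (a * b) = τ (b * a)
  faithful : ∀ a, τ (star a * a) = 0 → a = 0

theorem average_nonneg [PartialOrder A] [StarOrderedRing A] (h : IsCuntzAlgebra S) {a : A}
    (ha : 0 ≤ a) : 0 ≤ h.average a := by
  have hpi : (0 : ℝ) ≤ 2 * Real.pi := by positivity
  refine smul_nonneg (by positivity) ?_
  rw [intervalIntegral.integral_of_le hpi]
  exact integral_nonneg fun θ => map_nonneg (h.gauge _) ha

theorem exists_fixed_sqrt [PartialOrder A] [StarOrderedRing A] (h : IsCuntzAlgebra S)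
    (x : h.fixedPoints) (hx : 0 ≤ (x : A)) : ∃ b : h.fixedPoints, x = star b * b := by
  have hs : 0 ≤ CFC.sqrt (x : A) := CFC.sqrt_nonneg _
  refine ⟨⟨CFC.sqrt (x : A), fun z => ?_⟩, Subtype.ext ?_⟩
  · refine ((CFC.sqrt_eq_iff (x : A) _ hx (map_nonneg (h.gauge z) hs)).2 ?_).symm
    rw [← map_mul, CFC.sqrt_mul_sqrt_self (x : A) hx]
    exact x.2 z
  · change (x : A) = star (CFC.sqrt (x : A)) * CFC.sqrt (x : A)
    rw [hs.isSelfAdjoint.star_eq, CFC.sqrt_mul_sqrt_self (x : A) hx]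

/-- The KMS state `τ ∘ Φ` on `O_n`. -/
def kmsState [PartialOrder A] [StarOrderedRing A] (h : IsCuntzAlgebra S)
    (τ : h.fixedPoints →ₗ[ℂ] ℂ) (hτ : h.IsFaithfulNormalizedTrace τ) : A →ₚ[ℂ] ℂ :=
  PositiveLinearMap.mk₀ (τ ∘ₗ h.expectation) fun a ha => by
    obtain ⟨b, hb⟩ := h.exists_fixed_sqrt (h.expectation a) (h.average_nonneg ha)
    simp only [LinearMap.comp_apply, hb]
    exact hτ.nonneg b

theorem kmsState_apply [PartialOrder A] [StarOrderedRing A] (h : IsCuntzAlgebra S)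
    (τ : h.fixedPoints →ₗ[ℂ] ℂ) (hτ : h.IsFaithfulNormalizedTrace τ) (a : A) :
    h.kmsState τ hτ a = τ (h.expectation a) := rfl

end IsCuntzAlgebra

/-! ## Antilinear unbounded operators -/

/-- An antilinear relation on `H`: an additive subgroup of `H × H` stable under
`(ξ, η) ↦ (c ξ, conj c η)`; the graph of an antilinear operator is of this form. -/
structure AntilinearRel (H : Type*) [AddCommGroup H] [Module ℂ H] where
  graph : AddSubgroup (H × H)
  smul_mem : ∀ (c : ℂ) (p : H × H), p ∈ graph → (c • p.1, conj c • p.2) ∈ graph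

namespace AntilinearRel

variable {H : Type*} [NormedAddCommGroup H] [InnerProductSpace ℂ H]

/-- The closure in `H × H`. -/
def closure (G : AntilinearRel H) : AntilinearRel H where
  graph := G.graph.topologicalClosure
  smul_mem c p hp := by
    have hc : Continuous fun p : H × H => (c • p.1, conj c • p.2) := by fun_prop
    exact map_mem_closure (f := fun p : H × H => (c • p.1, conj c • p.2)) hc hp
      fun q hq => G.smul_mem c q hq

/-- The relation is the graph of an operator. -/
def IsFunctional (G : AntilinearRel H) : Prop :=
  ∀ η, ((0 : H), η) ∈ G.graph → η = 0

theorem IsFunctional.eq {G : AntilinearRel H} (hG : G.IsFunctional) {ξ η ζ : H}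
    (h₁ : (ξ, η) ∈ G.graph) (h₂ : (ξ, ζ) ∈ G.graph) : η = ζ := by
  have := G.graph.sub_mem h₁ h₂
  rw [Prod.mk_sub_mk, sub_self] at this
  exact sub_eq_zero.1 (hG _ this)

open scoped Classical in
/-- The antilinear operator with graph `G`; if `G` is not the graph of an operator, it is `0`. -/
def toOperator (G : AntilinearRel H) : H →ₛₗ.[starRingEnd ℂ] H where
  domain :=
    { carrier := {ξ | ∃ η, (ξ, η) ∈ G.graph}
      zero_mem' := ⟨0, G.graph.zero_mem⟩
      add_mem' := fun ⟨η, hη⟩ ⟨ζ, hζ⟩ => ⟨η + ζ, G.graph.add_mem hη hζ⟩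
      smul_mem' := fun c _ ⟨η, hη⟩ => ⟨conj c • η, G.smul_mem c _ hη⟩ }
  toFun := if hG : G.IsFunctional then
    { toFun := fun ξ => ξ.2.choose
      map_add' := fun x y => hG.eq (x + y).2.choose_spec
        (G.graph.add_mem x.2.choose_spec y.2.choose_spec)
      map_smul' := fun c x => hG.eq (c • x).2.choose_spec (G.smul_mem c _ x.2.choose_spec) }
    else 0

theorem toOperator_apply {G : AntilinearRel H} (hG : G.IsFunctional) (ξ : G.toOperator.domain) :
    ((ξ : H), G.toOperator ξ) ∈ G.graph := by
  have : G.toOperator ξ = ξ.2.choose := by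
    change G.toOperator.toFun ξ = _
    unfold toOperator
    simp only [dif_pos hG]
    rfl
  rw [this]
  exact ξ.2.choose_spec

end AntilinearRel

namespace AntilinearOperator

variable {H : Type*} [NormedAddCommGroup H] [InnerProductSpace ℂ H]

/-- The relation defining the adjoint of an antilinear operator:
`(η, ζ)` with `⟪T ξ, η⟫ = ⟪ζ, ξ⟫` for all `ξ` in the domain of `T`. -/
def adjointRel (T : H →ₛₗ.[starRingEnd ℂ] H) : AntilinearRel H where
  graph :=
    { carrier := {p | ∀ ξ : T.domain, ⟪T ξ, p.1⟫_ℂ = ⟪p.2, (ξ : H)⟫_ℂ}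
      zero_mem' := fun ξ => by simp
      add_mem' := fun hp hq ξ => by
        simp only [Prod.fst_add, Prod.snd_add, inner_add_left, inner_add_right, hp ξ, hq ξ]
      neg_mem' := fun hp ξ => by
        simp only [Prod.fst_neg, Prod.snd_neg, inner_neg_left, inner_neg_right, hp ξ] }
  smul_mem c p hp ξ := by
    have := hp ξ
    simp only [inner_smul_left, inner_smul_right, this, Complex.conj_conj]

/-- The adjoint `T^*` of a densely defined antilinear operator. -/
def adjoint (T : H →ₛₗ.[starRingEnd ℂ] H) : H →ₛₗ.[starRingEnd ℂ] H := (adjointRel T).toOperator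

/-- The composition `R T` of two antilinear operators, a linear operator
with domain `{ξ ∈ dom T | T ξ ∈ dom R}`. -/
def comp (R T : H →ₛₗ.[starRingEnd ℂ] H) : H →ₗ.[ℂ] H where
  domain :=
    { carrier := {ξ | ∃ hξ : ξ ∈ T.domain, T ⟨ξ, hξ⟩ ∈ R.domain}
      zero_mem' := ⟨T.domain.zero_mem, by
        have : T ⟨0, T.domain.zero_mem⟩ = 0 := T.map_zero
        rw [this]; exact R.domain.zero_mem⟩
      add_mem' := fun {ξ η} ⟨h₁, h₂⟩ ⟨h₃, h₄⟩ => ⟨T.domain.add_mem h₁ h₃, by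
        have : T ⟨ξ + η, T.domain.add_mem h₁ h₃⟩ = T ⟨ξ, h₁⟩ + T ⟨η, h₃⟩ :=
          T.map_add ⟨ξ, h₁⟩ ⟨η, h₃⟩
        rw [this]; exact R.domain.add_mem h₂ h₄⟩
      smul_mem' := fun c ξ ⟨h₁, h₂⟩ => ⟨T.domain.smul_mem c h₁, by
        have : T ⟨c • ξ, T.domain.smul_mem c h₁⟩ = conj c • T ⟨ξ, h₁⟩ :=
          T.map_smulₛₗ c ⟨ξ, h₁⟩
        rw [this]; exact R.domain.smul_mem _ h₂⟩ }
  toFun :=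
    { toFun := fun ξ => R ⟨T ⟨ξ, ξ.2.choose⟩, ξ.2.choose_spec⟩
      map_add' := fun ξ η => by
        rw [← R.map_add]
        congr 1
        apply Subtype.ext
        exact T.map_add ⟨ξ, ξ.2.choose⟩ ⟨η, η.2.choose⟩
      map_smul' := fun c ξ => by
        have h₁ : T ⟨(c • ξ :), (c • ξ).2.choose⟩ = conj c • T ⟨ξ, ξ.2.choose⟩ :=
          T.map_smulₛₗ c ⟨ξ, ξ.2.choose⟩
        have h₂ : R (conj c • ⟨T ⟨ξ, ξ.2.choose⟩, ξ.2.choose_spec⟩) =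
            conj (conj c) • R ⟨T ⟨ξ, ξ.2.choose⟩, ξ.2.choose_spec⟩ := R.map_smulₛₗ _ _
        rw [Complex.conj_conj] at h₂
        rw [RingHom.id_apply, ← h₂]
        congr 1
        exact Subtype.ext h₁ }

end AntilinearOperator

/-! ## Functional calculus of unbounded self-adjoint operators -/

/-- A projection-valued measure on the Borel sets of `ℝ`. -/
structure SpectralMeasure (H : Type*) [NormedAddCommGroup H] [InnerProductSpace ℂ H]
    [CompleteSpace H] where
  proj : Set ℝ → H →L[ℂ] H
  isStarProjection : ∀ s, MeasurableSet s → IsStarProjection (proj s)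
  univ : proj Set.univ = 1
  inter : ∀ s t, MeasurableSet s → MeasurableSet t → proj (s ∩ t) = proj s * proj t
  hasSum : ∀ s : ℕ → Set ℝ, (∀ i, MeasurableSet (s i)) → Pairwise (Function.onFun Disjoint s) →
    ∀ ξ, HasSum (fun i => proj (s i) ξ) (proj (⋃ i, s i) ξ)

namespace SpectralMeasure

variable {H : Type*} [NormedAddCommGroup H] [InnerProductSpace ℂ H] [CompleteSpace H]

theorem proj_empty (E : SpectralMeasure H) (ξ : H) : E.proj ∅ ξ = 0 := by
  have h := E.hasSum (fun _ => ∅) (fun _ => .empty) (fun _ _ _ => disjoint_bot_left) ξ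
  exact tendsto_nhds_unique tendsto_const_nhds h.summable.tendsto_atTop_zero

theorem re_inner_nonneg (E : SpectralMeasure H) {s : Set ℝ} (hs : MeasurableSet s) (ξ : H) :
    0 ≤ (⟪ξ, E.proj s ξ⟫_ℂ).re :=
  ((ContinuousLinearMap.nonneg_iff_isPositive _).1
    (E.isStarProjection s hs).nonneg).re_inner_nonneg_right ξ

/-- The finite measure `s ↦ ⟪ξ, E(s) ξ⟫`. -/
def measure (E : SpectralMeasure H) (ξ : H) : Measure ℝ :=
  Measure.ofMeasurable (fun s _ => ENNReal.ofReal (⟪ξ, E.proj s ξ⟫_ℂ).re)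
    (by simp [E.proj_empty])
    (fun s hs hd => by
      have h := (Complex.reCLM ∘L (innerSL ℂ ξ).restrictScalars ℝ).hasSum
        (E.hasSum s hs hd ξ)
      rw [← ENNReal.ofReal_tsum_of_nonneg (fun i => E.re_inner_nonneg (hs i) ξ) h.summable]
      congr 1
      exact h.tsum_eq.symm)

theorem measure_apply (E : SpectralMeasure H) (ξ : H) {s : Set ℝ} (hs : MeasurableSet s) :
    E.measure ξ s = ENNReal.ofReal (⟪ξ, E.proj s ξ⟫_ℂ).re :=
  Measure.ofMeasurable_apply s hs

/-- `T = ∫ f dE`: the domain of `T` is `{ξ | ∫ |f|² d⟪ξ, E ξ⟫ < ∞}`, and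
`⟪ξ, T ξ⟫ = ∫ f d⟪ξ, E ξ⟫` on it (by polarization this determines `T`). -/
def IsIntegral (E : SpectralMeasure H) (f : ℝ → ℂ) (T : H →ₗ.[ℂ] H) : Prop :=
  Measurable f ∧
  (∀ ξ : H, ξ ∈ T.domain ↔ Integrable (fun x => ‖f x‖ ^ 2) (E.measure ξ)) ∧
  ∀ ξ : T.domain, ⟪(ξ : H), T ξ⟫_ℂ = ∫ x, f x ∂(E.measure ξ)

end SpectralMeasure

/-- `R = f(T)` in the Borel functional calculus of the self-adjoint operator `T`:
`T = ∫ x dE` and `R = ∫ f dE` for a projection-valued measure `E` (the one of the spectral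
theorem, which is unique). In particular `T` is self-adjoint. -/
def IsBorelFunctionOf {H : Type*} [NormedAddCommGroup H] [InnerProductSpace ℂ H] [CompleteSpace H]
    (T : H →ₗ.[ℂ] H) (f : ℝ → ℂ) (R : H →ₗ.[ℂ] H) : Prop :=
  ∃ E : SpectralMeasure H, E.IsIntegral (fun x => (x : ℂ)) T ∧ E.IsIntegral f R

/-- A bounded operator as an unbounded operator with domain everything. -/
def everywhereDefined {H : Type*} [NormedAddCommGroup H] [InnerProductSpace ℂ H]
    (U : H →L[ℂ] H) : H →ₗ.[ℂ] H := (U : H →ₗ[ℂ] H).toPMap ⊤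

/-! ## Modular theory on the GNS space -/

section Modular

variable {n : ℕ} {A : Type*} [CStarAlgebra A] [PartialOrder A] [StarOrderedRing A]

/-- The vector of the GNS space `L²(A, ω)`, the completion of `A` for
`⟪a, b⟫ = ω (a^* b)`, given by `a ∈ A`. -/
def gnsVector (ω : A →ₚ[ℂ] ℂ) (a : A) : ω.GNS := ((ω.toPreGNS a : ω.PreGNS) : ω.GNS)

theorem gnsVector_add (ω : A →ₚ[ℂ] ℂ) (a b : A) :
    gnsVector ω (a + b) = gnsVector ω a + gnsVector ω b := by
  simp [gnsVector, UniformSpace.Completion.coe_add]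

theorem gnsVector_smul (ω : A →ₚ[ℂ] ℂ) (c : ℂ) (a : A) :
    gnsVector ω (c • a) = c • gnsVector ω a := by
  simp [gnsVector, UniformSpace.Completion.coe_smul]

theorem inner_gnsVector (ω : A →ₚ[ℂ] ℂ) (a b : A) :
    ⟪gnsVector ω a, gnsVector ω b⟫_ℂ = ω (star a * b) := by
  simp [gnsVector, UniformSpace.Completion.inner_coe, PositiveLinearMap.preGNS_inner_def]

/-- The relation `{(a, a^*) | a ∈ O_{nc}}` on the GNS space. -/
def preTomita (S : Fin n → A) (ω : A →ₚ[ℂ] ℂ) : AntilinearRel ω.GNS where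
  graph :=
    { carrier := {p | ∃ a ∈ cuntzCore S, p = (gnsVector ω a, gnsVector ω (star a))}
      zero_mem' := ⟨0, zero_mem _, by
        have h : gnsVector ω 0 = 0 := by simpa using gnsVector_smul ω 0 0
        rw [star_zero, h]; rfl⟩
      add_mem' := by
        rintro _ _ ⟨a, ha, rfl⟩ ⟨b, hb, rfl⟩
        exact ⟨a + b, add_mem ha hb, by simp [gnsVector_add]⟩
      neg_mem' := by
        rintro _ ⟨a, ha, rfl⟩
        refine ⟨(-1 : ℂ) • a, Submodule.smul_mem _ _ ha, ?_⟩
        simp only [star_smul, gnsVector_smul]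
        simp }
  smul_mem := by
    rintro c _ ⟨a, ha, rfl⟩
    exact ⟨c • a, Submodule.smul_mem _ _ ha, by simp [star_smul, gnsVector_smul]⟩

/-- The Tomita operator: the closure of `a ↦ a^*` on `O_{nc}`. -/
def tomitaOperator (S : Fin n → A) (ω : A →ₚ[ℂ] ℂ) : ω.GNS →ₛₗ.[starRingEnd ℂ] ω.GNS :=
  (preTomita S ω).closure.toOperator

/-- The modular operator `Δ = S^* S` of the Tomita operator `S`. -/
def modularOperator (S : Fin n → A) (ω : A →ₚ[ℂ] ℂ) : ω.GNS →ₗ.[ℂ] ω.GNS :=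
  AntilinearOperator.comp (AntilinearOperator.adjoint (tomitaOperator S ω)) (tomitaOperator S ω)

/-- The operator `D` on the GNS space: the closure of the linear operator on `O_{nc}` with
`D (S_μ S_ν^*) = (|μ| - |ν|) S_μ S_ν^*`. -/
def gaugeGenerator (S : Fin n → A) (ω : A →ₚ[ℂ] ℂ) : ω.GNS →ₗ.[ℂ] ω.GNS :=
  (Submodule.span ℂ {p : ω.GNS × ω.GNS | ∃ μ ν : List (Fin n),
    p = (gnsVector ω (cuntzMonomial S μ ν),
      ((μ.length : ℂ) - (ν.length : ℂ)) • gnsVector ω (cuntzMonomial S μ ν))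
    }).topologicalClosure.toLinearPMap

end Modular

end

/-!
The state `τ ∘ Φ` satisfies `ω (a b) = n^{|ν|-|μ|} ω (b a)` for `a = S_μ S_ν^*`: it suffices to
check this for `a = S_i`, where both sides are computed from `τ (S_μ S_ν^*) = δ_{μν} n^{-|μ|}`.
Hence monomials of different degrees `|μ| - |ν|` are orthogonal, so that `L²(O_n)` is the Hilbert
sum of the spectral subspaces `V_k` spanned by the monomials of degree `k`, and
`S_μ S_ν^* ↦ n^{(|μ|-|ν|)/2} S_ν S_μ^*` extends to an antilinear isometry `J` with `J² = 1`. The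
Tomita operator is `J Q`, where `Q` acts on `V_k` as `n^{-k/2}`, so `Δ` acts on `V_k` as `n^{-k}`
and `D` as `k`. All functions of these two operators can then be read off on each `V_k`.
-/

noncomputable section

/-! ### Diagonal operators -/

theorem inner_starProjection_self {𝕜 H : Type*} [RCLike 𝕜] [NormedAddCommGroup H]
    [InnerProductSpace 𝕜 H] (K : Submodule 𝕜 H) [K.HasOrthogonalProjection] (x : H) :
    ⟪x, K.starProjection x⟫_𝕜 = ((‖K.starProjection x‖ ^ 2 : ℝ) : 𝕜) := by
  rw [← K.starProjection_eq_self_iff.2 (K.starProjection_apply_mem x),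
    ← K.inner_starProjection_left_eq_right,
    K.starProjection_eq_self_iff.2 (K.starProjection_apply_mem x), inner_self_eq_norm_sq_to_K]
  simp only [RCLike.ofReal_pow]

/-- `H` is the Hilbert sum of its complete subspaces `V i`. -/
def IsInternalHilbertSum {𝕜 ι H : Type*} [RCLike 𝕜] [NormedAddCommGroup H]
    [InnerProductSpace 𝕜 H] [CompleteSpace H] (V : ι → Submodule 𝕜 H) : Prop :=
  IsHilbertSum 𝕜 (fun i => V i) fun i => (V i).subtypeₗᵢ

namespace IsInternalHilbertSum

variable {𝕜 ι H : Type*} [RCLike 𝕜] [NormedAddCommGroup H] [InnerProductSpace 𝕜 H]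
  [CompleteSpace H] {V : ι → Submodule 𝕜 H}

theorem summable_iff_norm_sq_summable (hV : IsInternalHilbertSum V) {v : ι → H}
    (hv : ∀ i, v i ∈ V i) : Summable v ↔ Summable fun i => ‖v i‖ ^ 2 :=
  hV.OrthogonalFamily.summable_iff_norm_sq_summable fun i => ⟨v i, hv i⟩

variable [∀ i, CompleteSpace (V i)]

theorem starProjection_of_mem_of_ne (hV : IsInternalHilbertSum V) {i j : ι} (hij : i ≠ j) {x : H}
    (hx : x ∈ V j) : (V i).starProjection x = 0 :=
  (V i).starProjection_apply_eq_zero_iff.2 <| (V i).mem_orthogonal x |>.2 fun u hu =>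
    hV.OrthogonalFamily hij ⟨u, hu⟩ ⟨x, hx⟩

theorem starProjection_of_hasSum (hV : IsInternalHilbertSum V) {v : ι → H} (hv : ∀ i, v i ∈ V i)
    {x : H} (hx : HasSum v x) (i : ι) : (V i).starProjection x = v i := by
  have hi := hasSum_single (f := fun j => (V i).starProjection (v j)) i fun j hj =>
    hV.starProjection_of_mem_of_ne hj.symm (hv j)
  rw [((V i).starProjection.hasSum hx).unique hi, (V i).starProjection_eq_self_iff.2 (hv i)]

theorem hasSum_starProjection (hV : IsInternalHilbertSum V) (x : H) :
    HasSum (fun i => (V i).starProjection x) x := by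
  obtain ⟨w, rfl⟩ := hV.linearIsometryEquiv.symm.surjective x
  have hw := hV.hasSum_linearIsometryEquiv_symm w
  simpa only [hV.starProjection_of_hasSum (fun i => (w i).2) hw] using! hw

theorem ext_starProjection (hV : IsInternalHilbertSum V) {x y : H}
    (h : ∀ i, (V i).starProjection x = (V i).starProjection y) : x = y :=
  (hV.hasSum_starProjection x).unique (by simpa only [h] using hV.hasSum_starProjection y)

theorem hasSum_inner_starProjection (hV : IsInternalHilbertSum V) (x y : H) :
    HasSum (fun i => ⟪x, (V i).starProjection y⟫_𝕜) ⟪x, y⟫_𝕜 :=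
  (innerSL 𝕜 x).hasSum (hV.hasSum_starProjection y)

theorem inner_congr (hV : IsInternalHilbertSum V) {x y x' y' : H}
    (h : ∀ i, ⟪x, (V i).starProjection y⟫_𝕜 = ⟪x', (V i).starProjection y'⟫_𝕜) :
    ⟪x, y⟫_𝕜 = ⟪x', y'⟫_𝕜 :=
  (hV.hasSum_inner_starProjection x y).unique
    (by simpa only [h] using hV.hasSum_inner_starProjection x' y')

theorem hasSum_norm_starProjection_sq (hV : IsInternalHilbertSum V) (x : H) :
    HasSum (fun i => ‖(V i).starProjection x‖ ^ 2) (‖x‖ ^ 2) := by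
  have h := hV.hasSum_inner_starProjection x x
  simp only [inner_starProjection_self, inner_self_eq_norm_sq_to_K] at h
  exact_mod_cast h

end IsInternalHilbertSum

section DiagonalOperator

variable {𝕜 ι H : Type*} [RCLike 𝕜] [NormedAddCommGroup H] [InnerProductSpace 𝕜 H]

/-- The diagonal operator acting on the summand `V i` as the scalar `f i`, with its maximal domain:
the vectors `x` for which `∑ i, f i • P i x` converges, `P i` being the projection onto `V i`. -/
def diagonalOperator (V : ι → Submodule 𝕜 H) [∀ i, (V i).HasOrthogonalProjection] (f : ι → 𝕜) :
    H →ₗ.[𝕜] H where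
  domain :=
    { carrier := {x | Summable fun i => f i • (V i).starProjection x}
      zero_mem' := by simp [summable_zero]
      add_mem' := fun hx hy => by
        simpa only [Set.mem_ofPred_eq, map_add, smul_add] using hx.add hy
      smul_mem' := fun c x hx => by
        simpa only [Set.mem_ofPred_eq, map_smul, smul_comm (f _) c] using hx.const_smul c }
  toFun :=
    { toFun := fun x => ∑' i, f i • (V i).starProjection (x : H)
      map_add' := fun x y => by
        simpa only [Submodule.coe_add, map_add, smul_add] using x.2.tsum_add y.2
      map_smul' := fun c x => by
        simpa only [Submodule.coe_smul, map_smul, smul_comm (f _) c, RingHom.id_apply] using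
          x.2.tsum_const_smul c }

namespace diagonalOperator

variable [CompleteSpace H] {V : ι → Submodule 𝕜 H} [∀ i, CompleteSpace (V i)] {f : ι → 𝕜}

theorem mem_domain_iff (hV : IsInternalHilbertSum V) {x : H} :
    x ∈ (diagonalOperator V f).domain ↔
      Summable fun i => ‖f i‖ ^ 2 * ‖(V i).starProjection x‖ ^ 2 := by
  simp only [← mul_pow, ← norm_smul]
  exact hV.summable_iff_norm_sq_summable fun i =>
    (V i).smul_mem _ ((V i).starProjection_apply_mem x)

theorem starProjection_apply (hV : IsInternalHilbertSum V) (x : (diagonalOperator V f).domain)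
    (i : ι) :
    (V i).starProjection (diagonalOperator V f x) = f i • (V i).starProjection (x : H) :=
  hV.starProjection_of_hasSum
    (fun i => (V i).smul_mem _ ((V i).starProjection_apply_mem (x : H))) (Summable.hasSum x.2) i

theorem mem_graph_iff (hV : IsInternalHilbertSum V) {p : H × H} :
    p ∈ (diagonalOperator V f).graph ↔
      ∀ i, (V i).starProjection p.2 = f i • (V i).starProjection p.1 := by
  rw [LinearPMap.mem_graph_iff]
  constructor
  · rintro ⟨x, hx, hy⟩ i
    rw [← hx, ← hy, starProjection_apply hV]
  · intro h
    have hs : HasSum (fun i => f i • (V i).starProjection p.1) p.2 := by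
      simpa only [h] using hV.hasSum_starProjection p.2
    exact ⟨⟨p.1, hs.summable⟩, rfl, hs.tsum_eq⟩

theorem mk_mem_graph_of_mem (hV : IsInternalHilbertSum V) {i : ι} {x : H} (hx : x ∈ V i) :
    (x, f i • x) ∈ (diagonalOperator V f).graph := by
  refine (mem_graph_iff hV).2 fun j => ?_
  obtain rfl | hji := eq_or_ne j i
  · exact map_smul _ _ _
  · simp only [map_smul, hV.starProjection_of_mem_of_ne hji hx, smul_zero]

theorem mem_domain_of_mem (hV : IsInternalHilbertSum V) {i : ι} {x : H} (hx : x ∈ V i) :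
    x ∈ (diagonalOperator V f).domain :=
  LinearPMap.mem_domain_of_mem_graph (mk_mem_graph_of_mem hV hx)

theorem apply_of_mem (hV : IsInternalHilbertSum V) {i : ι} {x : H} (hx : x ∈ V i)
    (hx' : x ∈ (diagonalOperator V f).domain) : diagonalOperator V f ⟨x, hx'⟩ = f i • x :=
  LinearPMap.mem_graph_snd_inj _ (LinearPMap.mem_graph _ _) (mk_mem_graph_of_mem hV hx) rfl

theorem isClosed_graph (hV : IsInternalHilbertSum V) :
    IsClosed ((diagonalOperator V f).graph : Set (H × H)) := by
  have h : ((diagonalOperator V f).graph : Set (H × H)) =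
      ⋂ i, {p | (V i).starProjection p.2 = f i • (V i).starProjection p.1} := by
    ext p
    simp only [SetLike.mem_coe, mem_graph_iff hV, Set.mem_iInter, Set.mem_ofPred_eq]
  rw [h]
  exact isClosed_iInter fun i => isClosed_eq (by fun_prop) (by fun_prop)

theorem graph_eq_topologicalClosure_span (hV : IsInternalHilbertSum V) {X : ι → Set H}
    (hX : ∀ i, V i = (Submodule.span 𝕜 (X i)).topologicalClosure) :
    (diagonalOperator V f).graph =
      (Submodule.span 𝕜 {p : H × H | ∃ i, ∃ x ∈ X i, p = (x, f i • x)}).topologicalClosure := by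
  set G := Submodule.span 𝕜 {p : H × H | ∃ i, ∃ x ∈ X i, p = (x, f i • x)}
  have mem_V {i x} (hx : x ∈ X i) : x ∈ V i :=
    hX i ▸ Submodule.le_topologicalClosure _ (Submodule.subset_span hx)
  have mem_G {i x} (hx : x ∈ V i) : (x, f i • x) ∈ G.topologicalClosure := by
    let L : H →L[𝕜] H × H := (ContinuousLinearMap.id 𝕜 H).prod (f i • ContinuousLinearMap.id 𝕜 H)
    have hL : Submodule.span 𝕜 (X i) ≤ G.comap L.toLinearMap :=
      Submodule.span_le.2 fun y hy => Submodule.subset_span ⟨i, y, hy, rfl⟩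
    rw [hX i] at hx
    exact map_mem_closure (f := L) L.continuous hx hL
  apply le_antisymm
  · intro p hp
    rw [mem_graph_iff hV] at hp
    have hs : HasSum (fun i => ((V i).starProjection p.1, f i • (V i).starProjection p.1)) p := by
      simpa only [hp] using
        (hV.hasSum_starProjection p.1).prodMk (hV.hasSum_starProjection p.2)
    exact G.isClosed_topologicalClosure.mem_of_tendsto hs <| Eventually.of_forall fun _ =>
      sum_mem fun i _ => mem_G ((V i).starProjection_apply_mem p.1)
  · refine Submodule.topologicalClosure_minimal _ (Submodule.span_le.2 ?_) (isClosed_graph hV)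
    rintro _ ⟨i, x, hx, rfl⟩
    exact mk_mem_graph_of_mem hV (mem_V hx)

theorem dense_domain (hV : IsInternalHilbertSum V) :
    Dense ((diagonalOperator V f).domain : Set H) := fun x =>
  mem_closure_of_tendsto (hV.hasSum_starProjection x) <| Eventually.of_forall fun _ =>
    sum_mem fun i _ => mem_domain_of_mem hV ((V i).starProjection_apply_mem x)

theorem mem_adjoint_graph_iff (hV : IsInternalHilbertSum V) {p : H × H} :
    p ∈ (diagonalOperator V f).graph.adjoint ↔
      ∀ i, (V i).starProjection p.2 = star (f i) • (V i).starProjection p.1 := by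
  simp only [Submodule.mem_adjoint_iff, sub_eq_zero]
  constructor
  · refine fun h i => ext_inner_left 𝕜 fun v => ?_
    have hi := h _ _ (mk_mem_graph_of_mem hV ((V i).starProjection_apply_mem v))
    rw [inner_smul_right, ← Submodule.inner_starProjection_left_eq_right,
      ← Submodule.inner_starProjection_left_eq_right, ← hi, inner_smul_left]
    rfl
  · intro h a b hab
    rw [mem_graph_iff hV] at hab
    refine hV.inner_congr fun i => ?_
    rw [← Submodule.inner_starProjection_left_eq_right, hab, h, inner_smul_left, inner_smul_right,
      Submodule.inner_starProjection_left_eq_right]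
    rfl

theorem adjoint_eq (hV : IsInternalHilbertSum V) :
    (diagonalOperator V f).adjoint = diagonalOperator V (star f) := by
  refine LinearPMap.eq_of_eq_graph (SetLike.ext fun p => ?_)
  rw [LinearPMap.adjoint_graph_eq_graph_adjoint (dense_domain hV), mem_adjoint_graph_iff hV,
    mem_graph_iff hV]
  rfl

theorem isSelfAdjoint (hV : IsInternalHilbertSum V) (hf : IsSelfAdjoint f) :
    IsSelfAdjoint (diagonalOperator V f) := by
  rw [LinearPMap.isSelfAdjoint_def, adjoint_eq hV, hf.star_eq]

theorem exists_mem_graph_and_mem_graph_iff (hV : IsInternalHilbertSum V) {x z : H} :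
    (∃ y, (x, y) ∈ (diagonalOperator V f).graph ∧ (y, z) ∈ (diagonalOperator V f).graph) ↔
      (x, z) ∈ (diagonalOperator V (f ^ 2)).graph := by
  simp only [mem_graph_iff hV, pow_two, Pi.mul_apply, mul_smul]
  constructor
  · rintro ⟨y, hxy, hyz⟩ i
    rw [hyz, hxy]
  · intro h
    have hx : x ∈ (diagonalOperator V f).domain := by
      refine (mem_domain_iff hV).2 <| .of_nonneg_of_le (fun i => by positivity) (fun i => ?_)
        ((hV.hasSum_norm_starProjection_sq x).summable.add
          (hV.hasSum_norm_starProjection_sq z).summable)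
      rw [h, norm_smul, norm_smul]
      -- `‖f‖² ‖x‖² ≤ ‖x‖² + ‖f‖⁴ ‖x‖²`
      nlinarith [mul_nonneg (sq_nonneg (‖f i‖ ^ 2 - 1)) (sq_nonneg ‖(V i).starProjection x‖),
        mul_nonneg (sq_nonneg ‖f i‖) (sq_nonneg ‖(V i).starProjection x‖)]
    refine ⟨diagonalOperator V f ⟨x, hx⟩, fun i => starProjection_apply hV ⟨x, hx⟩ i, fun i => ?_⟩
    rw [h, starProjection_apply hV]

theorem domain_eq_top {C : ℝ} (hV : IsInternalHilbertSum V) (hf : ∀ i, ‖f i‖ ≤ C) :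
    (diagonalOperator V f).domain = ⊤ := by
  refine Submodule.eq_top_iff'.2 fun x => (mem_domain_iff hV).2 <|
    ((hV.hasSum_norm_starProjection_sq x).summable.mul_left (C ^ 2)).of_nonneg_of_le
      (fun i => by positivity) fun i => by gcongr; exact hf i

theorem norm_apply_le {C : ℝ} (hV : IsInternalHilbertSum V) (hC : 0 ≤ C) (hf : ∀ i, ‖f i‖ ≤ C)
    (x : (diagonalOperator V f).domain) : ‖diagonalOperator V f x‖ ≤ C * ‖x‖ := by
  refine le_of_sq_le_sq ?_ (by positivity)
  rw [mul_pow]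
  refine hasSum_le (fun i => ?_) (hV.hasSum_norm_starProjection_sq _)
    ((hV.hasSum_norm_starProjection_sq (x : H)).mul_left (C ^ 2))
  rw [starProjection_apply hV, norm_smul, mul_pow]
  gcongr
  exact hf i

end diagonalOperator

/-- The diagonal operator with eigenvalues `f i` bounded by `C`, as a bounded operator. -/
def boundedDiagonalOperator [CompleteSpace H] {V : ι → Submodule 𝕜 H} [∀ i, CompleteSpace (V i)]
    (hV : IsInternalHilbertSum V) (f : ι → 𝕜) (C : NNReal) (hf : ∀ i, ‖f i‖ ≤ C) : H →L[𝕜] H :=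
  ((diagonalOperator V f).toFun ∘ₗ LinearMap.id.codRestrict _ fun x =>
    (diagonalOperator.domain_eq_top hV hf).ge (Submodule.mem_top (x := x))).mkContinuous C
      fun _ => diagonalOperator.norm_apply_le hV C.2 hf _

namespace boundedDiagonalOperator

variable [CompleteSpace H] {V : ι → Submodule 𝕜 H} [∀ i, CompleteSpace (V i)] {f : ι → 𝕜}
  {C : NNReal} {hf : ∀ i, ‖f i‖ ≤ C}

theorem starProjection_apply (hV : IsInternalHilbertSum V) (x : H) (i : ι) :
    (V i).starProjection (boundedDiagonalOperator hV f C hf x) = f i • (V i).starProjection x :=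
  diagonalOperator.starProjection_apply hV _ i

theorem apply_of_mem (hV : IsInternalHilbertSum V) {i : ι} {x : H} (hx : x ∈ V i) :
    boundedDiagonalOperator hV f C hf x = f i • x :=
  diagonalOperator.apply_of_mem hV hx _

end boundedDiagonalOperator

end DiagonalOperator

section Spectral

variable {ι H : Type*} [NormedAddCommGroup H] [InnerProductSpace ℂ H] [CompleteSpace H]
  {V : ι → Submodule ℂ H} [∀ i, CompleteSpace (V i)]

theorem everywhereDefined_boundedDiagonalOperator (hV : IsInternalHilbertSum V) {f : ι → ℂ}
    {C : NNReal} (hf : ∀ i, ‖f i‖ ≤ C) :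
    everywhereDefined (boundedDiagonalOperator hV f C hf) = diagonalOperator V f :=
  LinearPMap.ext (diagonalOperator.domain_eq_top hV hf).symm fun _ _ _ => rfl

/-- The projection onto the sum of the summands `V i` with `i ∈ s`. -/
def summandProjection (hV : IsInternalHilbertSum V) (s : Set ι) : H →L[ℂ] H :=
  boundedDiagonalOperator hV (s.indicator 1) 1 fun i => by
    by_cases h : i ∈ s <;> simp [h]

namespace summandProjection

theorem starProjection_apply (hV : IsInternalHilbertSum V) (s : Set ι) (x : H) (i : ι) :
    (V i).starProjection (summandProjection hV s x) =
      s.indicator (fun i => (V i).starProjection x) i := by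
  rw [summandProjection, boundedDiagonalOperator.starProjection_apply hV]
  by_cases h : i ∈ s <;> simp [h]

theorem hasSum_apply (hV : IsInternalHilbertSum V) (s : Set ι) (x : H) :
    HasSum (fun i : s => (V i).starProjection x) (summandProjection hV s x) :=
  (hasSum_subtype_iff_indicator (f := fun i => (V i).starProjection x)).2 <| by
    simpa only [starProjection_apply] using hV.hasSum_starProjection (summandProjection hV s x)

theorem univ_eq (hV : IsInternalHilbertSum V) : summandProjection hV Set.univ = 1 :=
  ContinuousLinearMap.ext fun x => hV.ext_starProjection fun i => by
    rw [starProjection_apply, Set.indicator_univ, one_apply_eq_self]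

theorem inter_eq (hV : IsInternalHilbertSum V) (s t : Set ι) :
    summandProjection hV (s ∩ t) = summandProjection hV s * summandProjection hV t :=
  ContinuousLinearMap.ext fun x => hV.ext_starProjection fun i => by
    rw [mul_apply_eq_comp, starProjection_apply, starProjection_apply, ← Set.indicator_indicator]
    simp only [starProjection_apply]

theorem isStarProjection (hV : IsInternalHilbertSum V) (s : Set ι) :
    IsStarProjection (summandProjection hV s) := by
  refine ⟨by rw [IsIdempotentElem, ← inter_eq, Set.inter_self],
    ContinuousLinearMap.isSelfAdjoint_iff_isSymmetric.2 fun x y => hV.inner_congr fun i => ?_⟩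
  rw [ContinuousLinearMap.coe_coe, ← Submodule.inner_starProjection_left_eq_right,
    starProjection_apply, starProjection_apply]
  by_cases h : i ∈ s <;> simp [h, Submodule.inner_starProjection_left_eq_right]

theorem hasSum_iUnion (hV : IsInternalHilbertSum V) {κ : Type*} {s : κ → Set ι}
    (hs : Pairwise (Function.onFun Disjoint s)) (x : H) :
    HasSum (fun k => summandProjection hV (s k) x) (summandProjection hV (⋃ k, s k) x) :=
  ((Set.unionEqSigmaOfDisjoint hs).symm.hasSum_iff.2 (hasSum_apply hV (⋃ k, s k) x)).sigma
    fun k => hasSum_apply hV (s k) x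

theorem hasSum_re_inner (hV : IsInternalHilbertSum V) (s : Set ι) (x : H) :
    HasSum (s.indicator fun i => ‖(V i).starProjection x‖ ^ 2)
      (⟪x, summandProjection hV s x⟫_ℂ).re := by
  have h := Complex.reCLM.hasSum (hV.hasSum_inner_starProjection x (summandProjection hV s x))
  have re_term (i : ι) : Complex.reCLM ⟪x, (V i).starProjection (summandProjection hV s x)⟫_ℂ =
      s.indicator (fun i => ‖(V i).starProjection x‖ ^ 2) i := by
    rw [starProjection_apply]
    by_cases hi : i ∈ s
    · rw [Set.indicator_of_mem hi, Set.indicator_of_mem hi, inner_starProjection_self]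
      rfl
    · simp [hi]
  exact funext re_term ▸ h

end summandProjection

/-- The spectral measure of a diagonal operator with eigenvalues `l i`. -/
def diagonalSpectralMeasure (hV : IsInternalHilbertSum V) (l : ι → ℝ) : SpectralMeasure H where
  proj s := summandProjection hV (l ⁻¹' s)
  isStarProjection s _ := summandProjection.isStarProjection hV _
  univ := summandProjection.univ_eq hV
  inter s t _ _ := summandProjection.inter_eq hV _ _
  hasSum s _ hs x := by
    rw [Set.preimage_iUnion]
    exact summandProjection.hasSum_iUnion hV (fun i j hij => (hs hij).preimage l) x

namespace diagonalSpectralMeasure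

theorem measure_eq_sum_dirac (hV : IsInternalHilbertSum V) (l : ι → ℝ) (x : H) :
    (diagonalSpectralMeasure hV l).measure x =
      Measure.sum fun i => ENNReal.ofReal (‖(V i).starProjection x‖ ^ 2) • Measure.dirac (l i) := by
  refine Measure.ext fun s hs => ?_
  have h := summandProjection.hasSum_re_inner hV (l ⁻¹' s) x
  rw [SpectralMeasure.measure_apply _ _ hs, Measure.sum_apply _ hs]
  change ENNReal.ofReal (⟪x, summandProjection hV (l ⁻¹' s) x⟫_ℂ).re = _
  rw [← h.tsum_eq, ENNReal.ofReal_tsum_of_nonneg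
    (Set.indicator_nonneg fun i _ => sq_nonneg _) h.summable]
  refine tsum_congr fun i => ?_
  rw [Measure.smul_apply, Measure.dirac_apply' _ hs]
  by_cases hi : l i ∈ s <;> simp [hi]

theorem isIntegral [Countable ι] (hV : IsInternalHilbertSum V) (l : ι → ℝ) {g : ℝ → ℂ}
    (hg : Measurable g) :
    (diagonalSpectralMeasure hV l).IsIntegral g (diagonalOperator V fun i => g (l i)) := by
  refine ⟨hg, fun x => ?_, fun x => ?_⟩
  · rw [diagonalOperator.mem_domain_iff hV, measure_eq_sum_dirac,
      integrable_sum_dirac_iff fun i => ENNReal.ofReal_ne_top]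
    refine summable_congr fun i => ?_
    rw [ENNReal.toReal_ofReal (sq_nonneg _), Real.norm_of_nonneg (sq_nonneg _), mul_comm]
  · rw [measure_eq_sum_dirac, integral_sum_dirac fun i => ENNReal.ofReal_ne_top,
      ← (hV.hasSum_inner_starProjection _ _).tsum_eq]
    refine tsum_congr fun i => ?_
    rw [diagonalOperator.starProjection_apply hV, inner_smul_right, inner_starProjection_self,
      ENNReal.toReal_ofReal (sq_nonneg _), Complex.real_smul, mul_comm]
    rfl

end diagonalSpectralMeasure

theorem isBorelFunctionOf_diagonalOperator [Countable ι] (hV : IsInternalHilbertSum V) (l : ι → ℝ)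
    {g : ℝ → ℂ} (hg : Measurable g) :
    IsBorelFunctionOf (diagonalOperator V fun i => (l i : ℂ)) g
      (diagonalOperator V fun i => g (l i)) :=
  ⟨diagonalSpectralMeasure hV l,
    diagonalSpectralMeasure.isIntegral hV l Complex.measurable_ofReal,
    diagonalSpectralMeasure.isIntegral hV l hg⟩

end Spectral

/-! ### The KMS condition -/

section Words

variable {n : ℕ} {A : Type*} [CStarAlgebra A] {S : Fin n → A}

theorem cuntzWord_cons (S : Fin n → A) (i : Fin n) (μ : List (Fin n)) :
    cuntzWord S (i :: μ) = S i * cuntzWord S μ := by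
  simp only [cuntzWord, List.map_cons, List.prod_cons]

theorem cuntzWord_append (S : Fin n → A) (μ ν : List (Fin n)) :
    cuntzWord S (μ ++ ν) = cuntzWord S μ * cuntzWord S ν := by
  simp only [cuntzWord, List.map_append, List.prod_append]

theorem cuntzMonomial_nil (S : Fin n → A) (μ : List (Fin n)) :
    cuntzMonomial S μ [] = cuntzWord S μ := by
  simp [cuntzMonomial, cuntzWord]

theorem mul_cuntzMonomial (S : Fin n → A) (i : Fin n) (μ ν : List (Fin n)) :
    S i * cuntzMonomial S μ ν = cuntzMonomial S (i :: μ) ν := by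
  rw [cuntzMonomial, cuntzMonomial, cuntzWord_cons, mul_assoc]

theorem star_cuntzMonomial (S : Fin n → A) (μ ν : List (Fin n)) :
    star (cuntzMonomial S μ ν) = cuntzMonomial S ν μ := by
  rw [cuntzMonomial, cuntzMonomial, star_mul, star_star]

theorem cuntzMonomial_mem_cuntzCore (S : Fin n → A) (μ ν : List (Fin n)) :
    cuntzMonomial S μ ν ∈ cuntzCore S :=
  Submodule.subset_span ⟨μ, ν, rfl⟩

theorem cuntzWord_mem_cuntzCore (S : Fin n → A) (μ : List (Fin n)) :
    cuntzWord S μ ∈ cuntzCore S :=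
  cuntzMonomial_nil S μ ▸ cuntzMonomial_mem_cuntzCore S μ []

theorem map_cuntzCore {E : Type*} [AddCommGroup E] [Module ℂ E] (L : A →ₗ[ℂ] E) :
    (cuntzCore S).map L =
      Submodule.span ℂ {x | ∃ μ ν : List (Fin n), x = L (cuntzMonomial S μ ν)} := by
  rw [cuntzCore, Submodule.map_span]
  congr 1
  ext x
  constructor
  · rintro ⟨_, ⟨μ, ν, rfl⟩, rfl⟩
    exact ⟨μ, ν, rfl⟩
  · rintro ⟨μ, ν, rfl⟩
    exact ⟨_, ⟨μ, ν, rfl⟩, rfl⟩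

namespace IsCuntzFamily

theorem star_mul_eq_zero (h : IsCuntzFamily S) {i j : Fin n} (hij : i ≠ j) :
    star (S i) * S j = 0 := by
  let _ := CStarAlgebra.spectralOrder A
  have _ := CStarAlgebra.spectralOrderedRing A
  have sum_eq_one : ∑ i, star (star (S i) * S j) * (star (S i) * S j) = 1 := by
    calc _ = star (S j) * (∑ i, S i * star (S i)) * S j := by
          simp only [Finset.mul_sum, Finset.sum_mul, star_mul, star_star, mul_assoc]
      _ = 1 := by rw [h.sum_range, mul_one, h.isometry]
  rw [← Finset.add_sum_erase _ _ (Finset.mem_univ j), h.isometry, star_one, one_mul,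
    add_eq_left, Finset.sum_eq_zero_iff_of_nonneg fun _ _ => star_mul_self_nonneg _] at sum_eq_one
  exact (CStarRing.star_mul_self_eq_zero_iff _).1
    (sum_eq_one i (Finset.mem_erase.2 ⟨hij, Finset.mem_univ i⟩))

theorem star_generator_mul_generator (h : IsCuntzFamily S) (i j : Fin n) :
    star (S i) * S j = if i = j then 1 else 0 := by
  split_ifs with hij
  · rw [hij, h.isometry]
  · exact h.star_mul_eq_zero hij

theorem star_cuntzWord_cons_mul_cuntzWord_cons (h : IsCuntzFamily S) (i j : Fin n)
    (μ ν : List (Fin n)) :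
    star (cuntzWord S (i :: μ)) * cuntzWord S (j :: ν) =
      if i = j then star (cuntzWord S μ) * cuntzWord S ν else 0 := by
  rw [cuntzWord_cons, cuntzWord_cons, star_mul, mul_assoc, ← mul_assoc (star (S i)),
    h.star_generator_mul_generator, ite_mul, one_mul, zero_mul, mul_ite, mul_zero]

theorem star_cuntzWord_mul_cuntzWord (h : IsCuntzFamily S) {μ ν : List (Fin n)}
    (hl : μ.length = ν.length) :
    star (cuntzWord S μ) * cuntzWord S ν = if μ = ν then 1 else 0 := by
  induction μ generalizing ν with
  | nil => simp [cuntzWord, List.length_eq_zero_iff.1 hl.symm]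
  | cons i μ ih =>
    obtain _ | ⟨j, ν⟩ := ν
    · simp at hl
    · rw [h.star_cuntzWord_cons_mul_cuntzWord_cons, ih (by simpa using hl), ← ite_and]
      simp only [List.cons.injEq]

theorem cuntzMonomial_mul_cuntzMonomial (h : IsCuntzFamily S) {μ ν ρ σ : List (Fin n)}
    (hl : ν.length = ρ.length) :
    cuntzMonomial S μ ν * cuntzMonomial S ρ σ = if ν = ρ then cuntzMonomial S μ σ else 0 := by
  rw [cuntzMonomial, cuntzMonomial, mul_assoc, ← mul_assoc (star _),
    h.star_cuntzWord_mul_cuntzWord hl, ite_mul, one_mul, zero_mul, mul_ite, mul_zero, cuntzMonomial]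

theorem cuntzMonomial_mul_mem_cuntzCore (h : IsCuntzFamily S) (μ ν ρ σ : List (Fin n)) :
    cuntzMonomial S μ ν * cuntzMonomial S ρ σ ∈ cuntzCore S := by
  induction ν generalizing ρ with
  | nil =>
    rw [cuntzMonomial_nil, cuntzMonomial, ← mul_assoc, ← cuntzWord_append]
    exact cuntzMonomial_mem_cuntzCore S _ _
  | cons i ν ih =>
    obtain _ | ⟨j, ρ⟩ := ρ
    · rw [← star_cuntzMonomial S σ [], cuntzMonomial_nil, cuntzMonomial, mul_assoc, ← star_mul,
        ← cuntzWord_append]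
      exact cuntzMonomial_mem_cuntzCore S _ _
    · have hmul : cuntzMonomial S μ (i :: ν) * cuntzMonomial S (j :: ρ) σ =
          if i = j then cuntzMonomial S μ ν * cuntzMonomial S ρ σ else 0 := by
        rw [cuntzMonomial, cuntzMonomial, mul_assoc, ← mul_assoc (star _),
          h.star_cuntzWord_cons_mul_cuntzWord_cons, ite_mul, zero_mul, mul_ite, mul_zero,
          cuntzMonomial, cuntzMonomial, mul_assoc, mul_assoc]
      rw [hmul]
      split_ifs
      exacts [ih ρ, zero_mem _]

theorem mul_mem_cuntzCore (h : IsCuntzFamily S) {a b : A} (ha : a ∈ cuntzCore S)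
    (hb : b ∈ cuntzCore S) : a * b ∈ cuntzCore S := by
  have hle : cuntzCore S * cuntzCore S ≤ cuntzCore S := by
    rw [cuntzCore, Submodule.span_mul_span, Submodule.span_le]
    rintro _ ⟨_, ⟨μ, ν, rfl⟩, _, ⟨ρ, σ, rfl⟩, rfl⟩
    exact h.cuntzMonomial_mul_mem_cuntzCore μ ν ρ σ
  exact hle (Submodule.mul_mem_mul ha hb)

theorem adjoin_le_cuntzCore (h : IsCuntzFamily S) {a : A}
    (ha : a ∈ StarAlgebra.adjoin ℂ (Set.range S)) : a ∈ cuntzCore S := by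
  induction ha using StarAlgebra.adjoin_induction with
  | mem x hx =>
    obtain ⟨i, rfl⟩ := hx
    simpa [cuntzWord] using cuntzWord_mem_cuntzCore S [i]
  | algebraMap r =>
    rw [Algebra.algebraMap_eq_smul_one]
    exact Submodule.smul_mem _ _ (cuntzWord_mem_cuntzCore S [])
  | add x y _ _ hx hy => exact add_mem hx hy
  | mul x y _ _ hx hy => exact h.mul_mem_cuntzCore hx hy
  | star x _ hx => exact star_mem_cuntzCore S hx

end IsCuntzFamily

theorem IsCuntzAlgebra.dense_cuntzCore (h : IsCuntzAlgebra S) : Dense (cuntzCore S : Set A) := by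
  refine Dense.mono (fun _ => h.family.adjoin_le_cuntzCore) (dense_iff_closure_eq.2 ?_)
  exact congrArg SetLike.coe h.generates

end Words

section ModularWeight

variable {n : ℕ} {A : Type*} [CStarAlgebra A] [PartialOrder A] {S : Fin n → A}
  {ω : A →ₚ[ℂ] ℂ} {a b : A} {c d : ℂ}

/-- The element `a` is an eigenvector of the modular group of `ω`, with eigenvalue `c` for the
modular operator: `ω (a b) = c ω (b a)` for every `b` in the dense subalgebra `O_{nc}`. -/
def HasModularWeight (S : Fin n → A) (ω : A →ₚ[ℂ] ℂ) (a : A) (c : ℂ) : Prop :=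
  ∀ b ∈ cuntzCore S, ω (a * b) = c * ω (b * a)

namespace HasModularWeight

theorem mul (h : IsCuntzFamily S) (ha : a ∈ cuntzCore S) (hb : b ∈ cuntzCore S)
    (hac : HasModularWeight S ω a c) (hbd : HasModularWeight S ω b d) :
    HasModularWeight S ω (a * b) (c * d) := fun x hx => by
  rw [mul_assoc, hac _ (h.mul_mem_cuntzCore hb hx), mul_assoc, hbd _ (h.mul_mem_cuntzCore hx ha),
    mul_assoc, mul_assoc]

protected theorem star [StarOrderedRing A] (hc : c ≠ 0) (hac : HasModularWeight S ω a c) :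
    HasModularWeight S ω (star a) (star c)⁻¹ := fun x hx => by
  have hx' := congrArg star (hac _ (star_mem_cuntzCore S hx))
  rw [star_mul', ← map_star, ← map_star, star_mul, star_mul, star_star] at hx'
  rw [hx', inv_mul_cancel_left₀ (star_ne_zero.2 hc)]

theorem cuntzWord (h : IsCuntzFamily S) (hS : ∀ i, HasModularWeight S ω (S i) c)
    (μ : List (Fin n)) : HasModularWeight S ω (cuntzWord S μ) (c ^ μ.length) := by
  induction μ with
  | nil => intro b _; simp [_root_.cuntzWord]
  | cons i μ ih =>
    rw [cuntzWord_cons, List.length_cons, pow_succ']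
    refine (hS i).mul h ?_ (cuntzWord_mem_cuntzCore S μ) ih
    simpa [_root_.cuntzWord] using cuntzWord_mem_cuntzCore S [i]

end HasModularWeight

/-- The state `ω` satisfies the KMS condition at inverse temperature `log n` for the gauge action,
expressed on the monomials `S_μ S_ν^*`. -/
def IsGaugeKMS (S : Fin n → A) (ω : A →ₚ[ℂ] ℂ) : Prop :=
  ∀ μ ν : List (Fin n),
    HasModularWeight S ω (cuntzMonomial S μ ν) ((n : ℂ) ^ ((ν.length : ℤ) - μ.length))

theorem IsGaugeKMS.of_generators [StarOrderedRing A] (h : IsCuntzFamily S)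
    (hS : ∀ i, HasModularWeight S ω (S i) (n : ℂ)⁻¹) (hn : (n : ℂ) ≠ 0) : IsGaugeKMS S ω := by
  intro μ ν
  have hν := (HasModularWeight.cuntzWord h hS ν).star (pow_ne_zero _ (inv_ne_zero hn))
  convert (HasModularWeight.cuntzWord h hS μ).mul h (cuntzWord_mem_cuntzCore S μ)
    (star_mem_cuntzCore S (cuntzWord_mem_cuntzCore S ν)) hν using 1
  · rfl
  · rw [star_pow, star_inv₀, star_natCast, inv_pow, inv_pow, inv_inv, zpow_sub₀ hn,
      zpow_natCast, zpow_natCast, div_eq_inv_mul]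

end ModularWeight

namespace IsCuntzAlgebra

section Gauge

variable {n : ℕ} {A : Type*} [CStarAlgebra A] {S : Fin n → A}

theorem gauge_one (h : IsCuntzAlgebra S) (a : A) : h.gauge 1 a = a := by
  have hid : h.gauge 1 = StarAlgHom.id ℂ A := h.hom_ext fun i => by
    rw [gauge_apply, Circle.coe_one, one_smul, StarAlgHom.coe_id, id]
  rw [hid, StarAlgHom.coe_id, id]

theorem gauge_cuntzWord (h : IsCuntzAlgebra S) (z : Circle) (μ : List (Fin n)) :
    h.gauge z (cuntzWord S μ) = (z : ℂ) ^ μ.length • cuntzWord S μ := by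
  induction μ with
  | nil => simp [cuntzWord]
  | cons i μ ih =>
    rw [cuntzWord_cons, map_mul, ih, gauge_apply, smul_mul_smul_comm, List.length_cons, pow_succ']

theorem gauge_cuntzMonomial (h : IsCuntzAlgebra S) (z : Circle) (μ ν : List (Fin n)) :
    h.gauge z (cuntzMonomial S μ ν) =
      (z : ℂ) ^ ((μ.length : ℤ) - ν.length) • cuntzMonomial S μ ν := by
  rw [cuntzMonomial, map_mul, map_star, gauge_cuntzWord, gauge_cuntzWord, star_smul,
    smul_mul_smul_comm, star_pow, Complex.star_def, ← Circle.coe_inv_eq_conj, Circle.coe_inv,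
    zpow_sub₀ (Circle.coe_ne_zero z), zpow_natCast, zpow_natCast, inv_pow, div_eq_mul_inv]

theorem cuntzMonomial_mem_fixedPoints (h : IsCuntzAlgebra S) {μ ν : List (Fin n)}
    (hl : μ.length = ν.length) : cuntzMonomial S μ ν ∈ h.fixedPoints := fun z => by
  rw [gauge_cuntzMonomial, hl, sub_self, zpow_zero, one_smul]

theorem average_of_gauge_eq_zpow_smul (h : IsCuntzAlgebra S) {a : A} {k : ℤ} (hk : k ≠ 0)
    (ha : ∀ z : Circle, h.gauge z a = (z : ℂ) ^ k • a) : h.average a = 0 := by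
  have hc : Complex.I * k ≠ 0 := mul_ne_zero Complex.I_ne_zero (Int.cast_ne_zero.2 hk)
  have gauge_exp (θ : ℝ) :
      h.gauge (Circle.exp θ) a = Complex.exp (Complex.I * k * θ) • a := by
    rw [ha, Circle.coe_exp, ← Complex.exp_int_mul]
    ring_nf
  have exp_period : Complex.exp (Complex.I * k * (2 * Real.pi : ℝ)) = 1 :=
    Complex.exp_eq_one_iff.2 ⟨k, by push_cast; ring⟩
  simp only [average, gauge_exp]
  rw [intervalIntegral.integral_smul_const, integral_exp_mul_complex hc, exp_period]
  simp

theorem average_of_mem_fixedPoints (h : IsCuntzAlgebra S) {a : A} (ha : a ∈ h.fixedPoints) :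
    h.average a = a := by
  have gauge_eq (z : Circle) : h.gauge z a = a := ha z
  simp only [average, gauge_eq]
  rw [intervalIntegral.integral_const, smul_smul, sub_zero,
    inv_mul_cancel₀ (by positivity), one_smul]

end Gauge

section KMS

variable {n : ℕ} {A : Type*} [CStarAlgebra A] [PartialOrder A] [StarOrderedRing A] {S : Fin n → A}
  (h : IsCuntzAlgebra S) {τ : h.fixedPoints →ₗ[ℂ] ℂ} (hτ : h.IsFaithfulNormalizedTrace τ)

theorem kmsState_of_gauge_eq_zpow_smul {a : A} {k : ℤ} (hk : k ≠ 0)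
    (ha : ∀ z : Circle, h.gauge z a = (z : ℂ) ^ k • a) : h.kmsState τ hτ a = 0 := by
  have hexp : h.expectation a = 0 := Subtype.ext (h.average_of_gauge_eq_zpow_smul hk ha)
  rw [kmsState_apply, hexp, map_zero]

theorem kmsState_coe (a : h.fixedPoints) : h.kmsState τ hτ a = τ a := by
  rw [kmsState_apply]
  exact congrArg τ (Subtype.ext (h.average_of_mem_fixedPoints a.2))

theorem kmsState_one : h.kmsState τ hτ 1 = 1 :=
  (h.kmsState_coe hτ 1).trans hτ.map_one

theorem kmsState_mul_comm {a b : A} (ha : a ∈ h.fixedPoints) (hb : b ∈ h.fixedPoints) :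
    h.kmsState τ hτ (a * b) = h.kmsState τ hτ (b * a) := by
  lift a to h.fixedPoints using ha
  lift b to h.fixedPoints using hb
  exact (h.kmsState_coe hτ (a * b)).trans <| (hτ.trace a b).trans (h.kmsState_coe hτ (b * a)).symm

include hτ in
theorem card_ne_zero : (n : ℂ) ≠ 0 := by
  rw [Nat.cast_ne_zero]
  rintro rfl
  have h1 := h.kmsState_one hτ
  rw [← h.family.sum_range] at h1
  simp at h1

theorem kmsState_cuntzMonomial_of_ne {μ ν : List (Fin n)} (hne : μ ≠ ν) :
    h.kmsState τ hτ (cuntzMonomial S μ ν) = 0 := by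
  by_cases hl : μ.length = ν.length
  · calc h.kmsState τ hτ (cuntzMonomial S μ ν)
        = h.kmsState τ hτ (cuntzMonomial S μ μ * cuntzMonomial S μ ν) := by
          rw [h.family.cuntzMonomial_mul_cuntzMonomial rfl, if_pos rfl]
      _ = h.kmsState τ hτ (cuntzMonomial S μ ν * cuntzMonomial S μ μ) :=
          h.kmsState_mul_comm hτ (h.cuntzMonomial_mem_fixedPoints rfl)
            (h.cuntzMonomial_mem_fixedPoints hl)
      _ = 0 := by
          rw [h.family.cuntzMonomial_mul_cuntzMonomial hl.symm, if_neg hne.symm, map_zero]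
  · exact h.kmsState_of_gauge_eq_zpow_smul hτ (sub_ne_zero.2 (by exact_mod_cast hl))
      fun z => h.gauge_cuntzMonomial z μ ν

theorem kmsState_cuntzMonomial_self_congr {μ ν : List (Fin n)} (hl : μ.length = ν.length) :
    h.kmsState τ hτ (cuntzMonomial S μ μ) = h.kmsState τ hτ (cuntzMonomial S ν ν) := by
  have hcomm := h.kmsState_mul_comm hτ (h.cuntzMonomial_mem_fixedPoints hl)
    (h.cuntzMonomial_mem_fixedPoints hl.symm)
  rwa [h.family.cuntzMonomial_mul_cuntzMonomial rfl, if_pos rfl,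
    h.family.cuntzMonomial_mul_cuntzMonomial rfl, if_pos rfl] at hcomm

theorem kmsState_cuntzMonomial_self (μ : List (Fin n)) :
    h.kmsState τ hτ (cuntzMonomial S μ μ) = (n : ℂ)⁻¹ ^ μ.length := by
  induction μ with
  | nil => simp [cuntzMonomial, cuntzWord, h.kmsState_one hτ]
  | cons i μ ih =>
    have hsum : cuntzMonomial S μ μ = ∑ j, cuntzMonomial S (μ ++ [j]) (μ ++ [j]) := by
      calc cuntzMonomial S μ μ
          = cuntzWord S μ * (∑ j, S j * star (S j)) * star (cuntzWord S μ) := by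
            rw [h.family.sum_range, mul_one, cuntzMonomial]
        _ = _ := by
            simp [Finset.mul_sum, Finset.sum_mul, cuntzMonomial, cuntzWord, mul_assoc]
    rw [hsum, map_sum, Finset.sum_congr rfl fun j _ =>
      h.kmsState_cuntzMonomial_self_congr hτ (μ := μ ++ [j]) (ν := i :: μ) (by simp)] at ih
    rw [List.length_cons, pow_succ', ← ih]
    simp [inv_mul_cancel_left₀ (h.card_ne_zero hτ)]

theorem kmsState_cuntzMonomial (μ ν : List (Fin n)) :
    h.kmsState τ hτ (cuntzMonomial S μ ν) = if μ = ν then (n : ℂ)⁻¹ ^ μ.length else 0 := by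
  split_ifs with hμν
  · rw [← hμν, h.kmsState_cuntzMonomial_self hτ]
  · exact h.kmsState_cuntzMonomial_of_ne hτ hμν

theorem kmsState_generator_mul_cuntzMonomial (μ ν : List (Fin n)) (i : Fin n) :
    h.kmsState τ hτ (S i * cuntzMonomial S μ ν) =
      (n : ℂ)⁻¹ * h.kmsState τ hτ (cuntzMonomial S μ ν * S i) := by
  rw [mul_cuntzMonomial, kmsState_cuntzMonomial]
  obtain _ | ⟨j, ν⟩ := ν
  · have hmul : cuntzMonomial S μ [] * S i = cuntzMonomial S (μ ++ [i]) [] := by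
      simp [cuntzMonomial, cuntzWord]
    simp [hmul, kmsState_cuntzMonomial]
  · have hmul : cuntzMonomial S μ (j :: ν) * S i = if j = i then cuntzMonomial S μ ν else 0 := by
      rw [cuntzMonomial, cuntzWord_cons, star_mul, mul_assoc, mul_assoc,
        h.family.star_generator_mul_generator, mul_ite, mul_one, mul_zero, mul_ite, mul_zero,
        cuntzMonomial]
    rw [hmul, apply_ite (h.kmsState τ hτ), map_zero, kmsState_cuntzMonomial, mul_ite, mul_ite,
      mul_zero, ← ite_and, List.length_cons, pow_succ']
    simp only [List.cons.injEq, eq_comm]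

theorem hasModularWeight_generator (i : Fin n) :
    HasModularWeight S (h.kmsState τ hτ) (S i) (n : ℂ)⁻¹ := fun b hb => by
  induction hb using Submodule.span_induction with
  | mem x hx =>
    obtain ⟨μ, ν, rfl⟩ := hx
    exact h.kmsState_generator_mul_cuntzMonomial hτ μ ν i
  | zero => simp
  | add x y _ _ hx hy => rw [mul_add, add_mul, map_add, map_add, hx, hy, mul_add]
  | smul c x _ hx =>
    rw [mul_smul_comm, smul_mul_assoc, map_smul, map_smul, hx, mul_smul_comm]

theorem isGaugeKMS_kmsState : IsGaugeKMS S (h.kmsState τ hτ) :=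
  .of_generators h.family (h.hasModularWeight_generator hτ) (h.card_ne_zero hτ)

end KMS

end IsCuntzAlgebra

/-! ### Antilinear isometries and polar decompositions -/

section AntilinearIsometry

variable {𝕜 E F : Type*} [RCLike 𝕜] [NormedAddCommGroup E] [InnerProductSpace 𝕜 E]
  [NormedAddCommGroup F] [InnerProductSpace 𝕜 F]

theorem inner_map_map_of_antilinear (J : E →ₛₗᵢ[starRingEnd 𝕜] F) (x y : E) :
    ⟪J x, J y⟫_𝕜 = ⟪y, x⟫_𝕜 := by
  have norm_add_smul (c : 𝕜) : ‖J x + c • J y‖ = ‖x + conj c • y‖ := by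
    rw [← J.norm_map, map_add, J.map_smulₛₗ, RCLike.conj_conj]
  have norm_sub_smul (c : 𝕜) : ‖J x - c • J y‖ = ‖x - conj c • y‖ := by
    simpa only [neg_smul, ← sub_eq_add_neg, map_neg] using norm_add_smul (-c)
  have norm_add : ‖J x + J y‖ = ‖x + y‖ := by rw [← map_add, J.norm_map]
  have norm_sub : ‖J x - J y‖ = ‖x - y‖ := by rw [← map_sub, J.norm_map]
  rw [← inner_conj_symm y x, inner_eq_sum_norm_sq_div_four, inner_eq_sum_norm_sq_div_four x y,
    norm_add, norm_sub, norm_add_smul, norm_sub_smul]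
  simp only [map_div₀, map_add, map_sub, map_mul, map_pow, RCLike.conj_ofReal, RCLike.conj_I,
    map_ofNat, sub_neg_eq_add, neg_smul, ← sub_eq_add_neg]
  ring

theorem exists_antilinearIsometry [CompleteSpace F] {κ : Type*} {e : κ → E} {f : κ → F}
    (hef : ∀ a b, ⟪f a, f b⟫_𝕜 = ⟪e b, e a⟫_𝕜)
    (he : Dense (Submodule.span 𝕜 (Set.range e) : Set E)) :
    ∃ J : E →ₛₗᵢ[starRingEnd 𝕜] F, ∀ a, J (e a) = f a := by
  let p : (κ →₀ 𝕜) →ₗ[𝕜] E := Finsupp.linearCombination 𝕜 e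
  let q : (κ →₀ 𝕜) →ₛₗ[starRingEnd 𝕜] F :=
    (Finsupp.linearCombination 𝕜 f).comp
      (Finsupp.mapRange.linearMap (starLinearEquiv 𝕜 (A := 𝕜)).toLinearMap)
  have p_single (a : κ) (c : 𝕜) : p (Finsupp.single a c) = c • e a := by simp [p]
  have q_single (a : κ) (c : 𝕜) : q (Finsupp.single a c) = conj c • f a := by simp [q]
  have norm_eq (c : κ →₀ 𝕜) : ‖q c‖ = ‖p c‖ := by
    suffices h : ⟪q c, q c⟫_𝕜 = ⟪p c, p c⟫_𝕜 by
      rw [@norm_eq_sqrt_re_inner 𝕜, h, ← @norm_eq_sqrt_re_inner 𝕜]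
    rw [← c.sum_single]
    simp only [Finsupp.sum, map_sum, p_single, q_single, sum_inner, inner_sum, inner_smul_left,
      inner_smul_right, RCLike.conj_conj, hef, Finset.mul_sum]
    rw [Finset.sum_comm]
    refine Finset.sum_congr rfl fun a _ => Finset.sum_congr rfl fun b _ => ?_
    ring
  have denseRange_p : DenseRange p := by
    rwa [DenseRange, ← LinearMap.coe_range, Finsupp.range_linearCombination]
  have extend_p (c : κ →₀ 𝕜) : q.extendOfNorm p (p c) = q c :=
    LinearMap.extendOfNorm_eq denseRange_p ⟨1, fun c => by rw [norm_eq, one_mul]⟩ c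
  refine ⟨⟨(q.extendOfNorm p).toLinearMap, fun x => ?_⟩, fun a => ?_⟩
  · refine denseRange_p.induction_on (p := fun x => ‖q.extendOfNorm p x‖ = ‖x‖) x
      (isClosed_eq (by fun_prop) (by fun_prop)) fun c => ?_
    rw [extend_p, norm_eq]
  · simpa [p_single, q_single] using extend_p (Finsupp.single a 1)

end AntilinearIsometry

theorem mem_graph_iff_of_isSelfAdjoint {𝕜 H : Type*} [RCLike 𝕜] [NormedAddCommGroup H]
    [InnerProductSpace 𝕜 H] [CompleteSpace H] {Q : H →ₗ.[𝕜] H} (hQ : IsSelfAdjoint Q) {y z : H} :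
    (y, z) ∈ Q.graph ↔ ∀ x : Q.domain, ⟪Q x, y⟫_𝕜 = ⟪(x : H), z⟫_𝕜 := by
  nth_rw 1 [← LinearPMap.isSelfAdjoint_def.1 hQ]
  rw [LinearPMap.adjoint_graph_eq_graph_adjoint hQ.dense_domain, Submodule.mem_adjoint_iff]
  simp only [sub_eq_zero]
  refine ⟨fun h x => h _ _ (Q.mem_graph x), fun h a b hab => ?_⟩
  obtain ⟨x, rfl, rfl⟩ := Q.mem_graph_iff.1 hab
  exact h x

namespace AntilinearRel

variable {H : Type*} [NormedAddCommGroup H] [InnerProductSpace ℂ H] {G K : AntilinearRel H}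
  {J : H →ₛₗᵢ[starRingEnd ℂ] H} {Q : H →ₗ.[ℂ] H}

theorem mem_graph_comp_toOperator_iff (hG : G.IsFunctional) (hK : K.IsFunctional) {p : H × H} :
    p ∈ (AntilinearOperator.comp K.toOperator G.toOperator).graph ↔
      ∃ η, (p.1, η) ∈ G.graph ∧ (η, p.2) ∈ K.graph := by
  rw [LinearPMap.mem_graph_iff]
  constructor
  · rintro ⟨ξ, hξ, hp⟩
    obtain ⟨mem_G, mem_K⟩ := ξ.2
    refine ⟨G.toOperator ⟨ξ, mem_G⟩, ?_, ?_⟩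
    · exact hξ ▸ toOperator_apply hG ⟨ξ, mem_G⟩
    · exact hp ▸ toOperator_apply hK ⟨_, mem_K⟩
  · rintro ⟨η, mem_G, mem_K⟩
    have hdom : p.1 ∈ G.toOperator.domain := ⟨η, mem_G⟩
    obtain rfl : η = G.toOperator ⟨p.1, hdom⟩ := hG.eq mem_G (toOperator_apply hG ⟨p.1, hdom⟩)
    exact ⟨⟨p.1, hdom, p.2, mem_K⟩, rfl, hK.eq (toOperator_apply hK ⟨_, p.2, mem_K⟩) mem_K⟩

theorem mem_closure_graph_iff (hJ : Function.Involutive J) {K : Set (H × H)}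
    (hK : ∀ ξ η, (ξ, η) ∈ G.graph ↔ (ξ, J η) ∈ K) (ξ η : H) :
    (ξ, η) ∈ G.closure.graph ↔ (ξ, J η) ∈ _root_.closure K := by
  let e : H × H ≃ₜ H × H := (Homeomorph.refl H).prodCongr
    ⟨hJ.toPerm, J.continuous, J.continuous⟩
  have graph_eq : (G.graph : Set (H × H)) = e ⁻¹' K := Set.ext fun p => hK p.1 p.2
  change (ξ, η) ∈ _root_.closure (G.graph : Set (H × H)) ↔ _
  rw [graph_eq, ← e.preimage_closure]
  rfl

/-- The relation `G` is the graph of `J Q`, where `J` is an antilinear isometric involution: the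
shape of the polar decomposition of a Tomita operator. Since `J² = 1`, the condition `η = J (Q ξ)`
is written as `Q ξ = J η`. -/
structure IsPolarDecomposition (G : AntilinearRel H) (J : H →ₛₗᵢ[starRingEnd ℂ] H)
    (Q : H →ₗ.[ℂ] H) : Prop where
  involutive : Function.Involutive J
  mem_graph_iff : ∀ ξ η, (ξ, η) ∈ G.graph ↔ (ξ, J η) ∈ Q.graph

namespace IsPolarDecomposition

theorem isFunctional (h : G.IsPolarDecomposition J Q) : G.IsFunctional := fun _ hη =>
  J.injective <| (LinearPMap.graph_fst_eq_zero_snd Q ((h.mem_graph_iff _ _).1 hη) rfl).trans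
    (map_zero J).symm

theorem mk_apply_mem_graph_iff (h : G.IsPolarDecomposition J Q) {ξ η : H} :
    (ξ, J η) ∈ G.graph ↔ (ξ, η) ∈ Q.graph := by
  rw [h.mem_graph_iff, h.involutive]

theorem mem_domain_iff (h : G.IsPolarDecomposition J Q) {ξ : H} :
    ξ ∈ G.toOperator.domain ↔ ξ ∈ Q.domain := by
  rw [LinearPMap.mem_domain_iff]
  exact ⟨fun ⟨η, hη⟩ => ⟨J η, (h.mem_graph_iff _ _).1 hη⟩,
    fun ⟨η, hη⟩ => ⟨J η, h.mk_apply_mem_graph_iff.2 hη⟩⟩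

theorem toOperator_apply_eq (h : G.IsPolarDecomposition J Q) (ξ : G.toOperator.domain)
    (η : Q.domain) (hξη : (ξ : H) = η) : G.toOperator ξ = J (Q η) :=
  h.isFunctional.eq (toOperator_apply h.isFunctional ξ) <|
    h.mk_apply_mem_graph_iff.2 (hξη ▸ Q.mem_graph η)

variable [CompleteSpace H]

theorem mem_adjointRel_graph_iff (h : G.IsPolarDecomposition J Q) (hQ : IsSelfAdjoint Q)
    {ξ η : H} : (ξ, η) ∈ (AntilinearOperator.adjointRel G.toOperator).graph ↔
      (J ξ, η) ∈ Q.graph := by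
  have inner_eq (x : H) : ⟪J x, ξ⟫_ℂ = ⟪J ξ, x⟫_ℂ := by
    rw [← inner_map_map_of_antilinear J, h.involutive]
  rw [mem_graph_iff_of_isSelfAdjoint hQ]
  refine ⟨fun hη x => ?_, fun hη x => ?_⟩
  · have hx : (x : H) ∈ G.toOperator.domain := h.mem_domain_iff.2 x.2
    have := hη ⟨x, hx⟩
    rw [h.toOperator_apply_eq ⟨x, hx⟩ x rfl, inner_eq] at this
    rw [← inner_conj_symm, this, inner_conj_symm]
  · have := hη ⟨x, h.mem_domain_iff.1 x.2⟩
    rw [h.toOperator_apply_eq x ⟨x, h.mem_domain_iff.1 x.2⟩ rfl, inner_eq]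
    rw [← inner_conj_symm, this, inner_conj_symm]

theorem adjointRel_isFunctional (h : G.IsPolarDecomposition J Q) (hQ : IsSelfAdjoint Q) :
    (AntilinearOperator.adjointRel G.toOperator).IsFunctional := fun _ hη =>
  LinearPMap.graph_fst_eq_zero_snd Q ((h.mem_adjointRel_graph_iff hQ).1 hη) (map_zero J)

theorem mem_adjoint_comp_self_graph_iff (h : G.IsPolarDecomposition J Q) (hQ : IsSelfAdjoint Q)
    {p : H × H} :
    p ∈ (AntilinearOperator.comp (AntilinearOperator.adjoint G.toOperator) G.toOperator).graph ↔
      ∃ η, (p.1, η) ∈ Q.graph ∧ (η, p.2) ∈ Q.graph := by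
  rw [AntilinearOperator.adjoint,
    mem_graph_comp_toOperator_iff h.isFunctional (h.adjointRel_isFunctional hQ)]
  simp only [h.mem_graph_iff, h.mem_adjointRel_graph_iff hQ]
  exact h.involutive.surjective.exists (p := fun η => (p.1, η) ∈ Q.graph ∧ (η, p.2) ∈ Q.graph).symm

end IsPolarDecomposition

end AntilinearRel

/-! ### The grading of the GNS space -/

section GNS

variable {A : Type*} [CStarAlgebra A] [PartialOrder A] [StarOrderedRing A] (ω : A →ₚ[ℂ] ℂ)

theorem gnsStarAlgHom_gnsVector (a b : A) :
    ω.gnsStarAlgHom a (gnsVector ω b) = gnsVector ω (a * b) := by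
  simp [gnsVector]

theorem continuous_gnsVector : Continuous (gnsVector ω) := by
  have hrep : Continuous ω.gnsStarAlgHom :=
    AddMonoidHomClass.continuous_of_bound ω.gnsStarAlgHom 1 fun a => by
      simpa using NonUnitalStarAlgHom.norm_apply_le ω.gnsStarAlgHom a
  have gnsVector_eq : gnsVector ω = fun a => ω.gnsStarAlgHom a (gnsVector ω 1) :=
    funext fun a => by rw [gnsStarAlgHom_gnsVector, mul_one]
  exact gnsVector_eq ▸ hrep.clm_apply continuous_const

/-- `gnsVector` as a continuous linear map. -/
def gnsVectorCLM : A →L[ℂ] ω.GNS where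
  toFun := gnsVector ω
  map_add' := gnsVector_add ω
  map_smul' := gnsVector_smul ω
  cont := continuous_gnsVector ω

theorem denseRange_gnsVectorCLM : DenseRange (gnsVectorCLM ω) :=
  UniformSpace.Completion.denseRange_coe.comp ω.toPreGNS.surjective.denseRange
    (UniformSpace.Completion.continuous_coe _)

end GNS

section Grading

variable {n : ℕ} {A : Type*} [CStarAlgebra A] [PartialOrder A] [StarOrderedRing A]
  {S : Fin n → A} {ω : A →ₚ[ℂ] ℂ}

/-- The vectors `S_μ S_ν^*` with `|μ| - |ν| = k`. -/
def homogeneousVectors (S : Fin n → A) (ω : A →ₚ[ℂ] ℂ) (k : ℤ) : Set ω.GNS :=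
  {v | ∃ μ ν : List (Fin n), (μ.length : ℤ) - ν.length = k ∧ v = gnsVector ω (cuntzMonomial S μ ν)}

/-- The spectral subspace of degree `k` of the gauge action on the GNS space. -/
def homogeneousSubspace (S : Fin n → A) (ω : A →ₚ[ℂ] ℂ) (k : ℤ) : Submodule ℂ ω.GNS :=
  (Submodule.span ℂ (homogeneousVectors S ω k)).topologicalClosure

instance homogeneousSubspace.completeSpace (k : ℤ) : CompleteSpace (homogeneousSubspace S ω k) :=
  (Submodule.isClosed_topologicalClosure _).completeSpace_coe

theorem gnsVector_mem_homogeneousSubspace (μ ν : List (Fin n)) :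
    gnsVector ω (cuntzMonomial S μ ν) ∈
      homogeneousSubspace S ω ((μ.length : ℤ) - ν.length) :=
  Submodule.le_topologicalClosure _ (Submodule.subset_span ⟨μ, ν, rfl, rfl⟩)

theorem IsCuntzAlgebra.dense_span_gnsVector_cuntzMonomial (hS : IsCuntzAlgebra S)
    (ω : A →ₚ[ℂ] ℂ) :
    Dense (Submodule.span ℂ (Set.range fun p : List (Fin n) × List (Fin n) =>
      gnsVector ω (cuntzMonomial S p.1 p.2)) : Set ω.GNS) := by
  have range_eq : (Set.range fun p : List (Fin n) × List (Fin n) =>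
      gnsVector ω (cuntzMonomial S p.1 p.2)) =
        {x | ∃ μ ν : List (Fin n), x = (gnsVectorCLM ω).toLinearMap (cuntzMonomial S μ ν)} :=
    Set.ext fun x => Prod.exists.trans (exists₂_congr fun _ _ => eq_comm)
  rw [range_eq, ← map_cuntzCore, Submodule.map_coe]
  exact (denseRange_gnsVectorCLM ω).dense_image (gnsVectorCLM ω).continuous hS.dense_cuntzCore

theorem IsGaugeKMS.inner_gnsVector_eq_zero (hω : IsGaugeKMS S ω) (hn : 1 < n)
    {μ ν ρ σ : List (Fin n)} (hne : (μ.length : ℤ) - ν.length ≠ (ρ.length : ℤ) - σ.length) :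
    ⟪gnsVector ω (cuntzMonomial S μ ν), gnsVector ω (cuntzMonomial S ρ σ)⟫_ℂ = 0 := by
  rw [inner_gnsVector, star_cuntzMonomial]
  have hcomm : ω (cuntzMonomial S ν μ * cuntzMonomial S ρ σ) =
      (n : ℂ) ^ ((μ.length : ℤ) - ν.length + (σ.length - ρ.length)) *
        ω (cuntzMonomial S ν μ * cuntzMonomial S ρ σ) := by
    rw [zpow_add₀ (by exact_mod_cast (zero_lt_one.trans hn).ne'), mul_assoc,
      ← hω ρ σ _ (cuntzMonomial_mem_cuntzCore S ν μ),
      ← hω ν μ _ (cuntzMonomial_mem_cuntzCore S ρ σ)]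
  by_contra h0
  have zpow_eq_one : (n : ℝ) ^ ((μ.length : ℤ) - ν.length + (σ.length - ρ.length)) = 1 :=
    Complex.ofReal_injective <| by simpa using (right_eq_mul₀ h0).1 hcomm
  rw [zpow_eq_one_iff_right₀ n.cast_nonneg (by exact_mod_cast hn.ne')] at zpow_eq_one
  exact hne (by omega)

theorem IsGaugeKMS.isInternalHilbertSum (hω : IsGaugeKMS S ω) (hS : IsCuntzAlgebra S)
    (hn : 1 < n) : IsInternalHilbertSum (homogeneousSubspace S ω) := by
  refine IsHilbertSum.mkInternal _ (OrthogonalFamily.of_pairwise fun k l hkl => ?_) ?_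
  · refine Submodule.isOrtho_iff_le.2 <|
      Submodule.topologicalClosure_minimal _ ?_ (Submodule.isClosed_orthogonal _)
    rw [homogeneousSubspace, Submodule.orthogonal_closure]
    refine Submodule.isOrtho_span.2 ?_
    rintro _ ⟨μ, ν, rfl, rfl⟩ _ ⟨ρ, σ, rfl, rfl⟩
    exact hω.inner_gnsVector_eq_zero hn hkl
  · rw [← Submodule.dense_iff_topologicalClosure_eq_top.1 (hS.dense_span_gnsVector_cuntzMonomial ω)]
    refine Submodule.topologicalClosure_mono (Submodule.span_le.2 ?_)
    rintro _ ⟨⟨μ, ν⟩, rfl⟩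
    exact Submodule.mem_iSup_of_mem _ (gnsVector_mem_homogeneousSubspace μ ν)

variable (hV : IsInternalHilbertSum (homogeneousSubspace S ω))

include hV in
theorem diagonalOperator_homogeneousSubspace_graph (f : ℤ → ℂ) :
    (diagonalOperator (homogeneousSubspace S ω) f).graph =
      (Submodule.span ℂ {p | ∃ μ ν : List (Fin n),
        p = (gnsVector ω (cuntzMonomial S μ ν),
          f ((μ.length : ℤ) - ν.length) •
            gnsVector ω (cuntzMonomial S μ ν))}).topologicalClosure := by
  rw [diagonalOperator.graph_eq_topologicalClosure_span hV (X := homogeneousVectors S ω)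
    fun k => rfl]
  congr 2
  ext p
  constructor
  · rintro ⟨_, _, ⟨μ, ν, rfl, rfl⟩, rfl⟩
    exact ⟨μ, ν, rfl⟩
  · rintro ⟨μ, ν, rfl⟩
    exact ⟨_, _, ⟨μ, ν, rfl, rfl⟩, rfl⟩

include hV in
theorem gaugeGenerator_eq :
    gaugeGenerator S ω = diagonalOperator (homogeneousSubspace S ω) fun k => ((k : ℝ) : ℂ) := by
  have hgraph := diagonalOperator_homogeneousSubspace_graph hV fun k => ((k : ℝ) : ℂ)
  simp only [Int.cast_sub, Int.cast_natCast, Complex.ofReal_sub, Complex.ofReal_natCast] at hgraph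
  refine LinearPMap.eq_of_eq_graph ?_
  rw [gaugeGenerator, ← hgraph]
  exact Submodule.toLinearPMap_graph_eq _ fun p hp hp0 =>
    LinearPMap.graph_fst_eq_zero_snd _ hp hp0

/-- The unitary on the GNS space implementing the gauge automorphism `γ_z`. -/
def gaugeUnitary (z : Circle) : ω.GNS →L[ℂ] ω.GNS :=
  boundedDiagonalOperator hV (fun k => (z : ℂ) ^ k) 1 fun k => by
    rw [norm_zpow, Circle.norm_coe, one_zpow, NNReal.coe_one]

theorem everywhereDefined_gaugeUnitary (z : Circle) :
    everywhereDefined (gaugeUnitary hV z) =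
      diagonalOperator (homogeneousSubspace S ω) fun k => (z : ℂ) ^ k :=
  everywhereDefined_boundedDiagonalOperator hV _

theorem gaugeUnitary_gnsVector (hS : IsCuntzAlgebra S) (z : Circle) (a : A) :
    gaugeUnitary hV z (gnsVector ω a) = gnsVector ω (hS.gauge z a) := by
  let γ : A →L[ℂ] A := ⟨(hS.gauge z).toAlgHom.toLinearMap, IsCuntzAlgebra.continuous_hom _⟩
  suffices h : gaugeUnitary hV z ∘L gnsVectorCLM ω = gnsVectorCLM ω ∘L γ from
    DFunLike.congr_fun h a
  refine ContinuousLinearMap.ext_on hS.dense_cuntzCore ?_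
  rintro _ ⟨μ, ν, rfl⟩
  calc gaugeUnitary hV z (gnsVector ω (cuntzMonomial S μ ν))
      = (z : ℂ) ^ ((μ.length : ℤ) - ν.length) • gnsVector ω (cuntzMonomial S μ ν) :=
        boundedDiagonalOperator.apply_of_mem hV (gnsVector_mem_homogeneousSubspace μ ν)
    _ = gnsVector ω (hS.gauge z (cuntzMonomial S μ ν)) := by
        rw [hS.gauge_cuntzMonomial, gnsVector_smul]

theorem gaugeUnitary_mul_gnsStarAlgHom_mul (hS : IsCuntzAlgebra S) (z : Circle) (a : A) :
    gaugeUnitary hV z * ω.gnsStarAlgHom a * gaugeUnitary hV z⁻¹ =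
      ω.gnsStarAlgHom (hS.gauge z a) := by
  refine ContinuousLinearMap.ext_on
    ((denseRange_gnsVectorCLM ω).mono Submodule.subset_span) ?_
  rintro _ ⟨b, rfl⟩
  change gaugeUnitary hV z (ω.gnsStarAlgHom a (gaugeUnitary hV z⁻¹ (gnsVector ω b))) =
    ω.gnsStarAlgHom (hS.gauge z a) (gnsVector ω b)
  rw [gaugeUnitary_gnsVector hV hS, gnsStarAlgHom_gnsVector, gaugeUnitary_gnsVector hV hS,
    gnsStarAlgHom_gnsVector, map_mul, hS.gauge_mul, mul_inv_cancel, hS.gauge_one]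

end Grading

/-! ### The modular operator -/

section Exponentials

theorem circleExp_zpow (t : ℝ) (k : ℤ) :
    (Circle.exp t : ℂ) ^ k = Complex.exp (Complex.I * t * k) := by
  rw [Circle.coe_exp, ← Complex.exp_int_mul]
  ring_nf

theorem natCast_zpow_eq_exp {n : ℕ} (hn : n ≠ 0) (k : ℤ) :
    (n : ℂ) ^ k = Complex.exp (k * Real.log n) := by
  rw [Complex.exp_int_mul, ← Complex.ofReal_exp, Real.exp_log (by positivity),
    Complex.ofReal_natCast]

theorem ofReal_zpow_cpow {x : ℝ} (hx : 0 < x) (k : ℤ) (s : ℂ) :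
    ((x ^ k : ℝ) : ℂ) ^ s = Complex.exp (s * k * Real.log x) := by
  rw [Complex.cpow_def_of_ne_zero (Complex.ofReal_ne_zero.2 (by positivity)),
    ← Complex.ofReal_log (by positivity), Real.log_zpow]
  push_cast
  ring_nf

end Exponentials

section Tomita

variable {n : ℕ} {A : Type*} [CStarAlgebra A] [PartialOrder A] [StarOrderedRing A]
  {S : Fin n → A} {ω : A →ₚ[ℂ] ℂ}

/-- The antilinear isometry `J` is the modular conjugation: `J = S Δ^{-1/2}` on the monomials
`S_μ S_ν^*`. -/
def IsModularConjugation (S : Fin n → A) (ω : A →ₚ[ℂ] ℂ)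
    (J : ω.GNS →ₛₗᵢ[starRingEnd ℂ] ω.GNS) : Prop :=
  ∀ μ ν : List (Fin n), J (gnsVector ω (cuntzMonomial S μ ν)) =
    ((√((n : ℝ) ^ ((μ.length : ℤ) - ν.length)) : ℝ) : ℂ) • gnsVector ω (cuntzMonomial S ν μ)

theorem IsGaugeKMS.inner_sqrt_smul_gnsVector (hω : IsGaugeKMS S ω) (hn : 1 < n)
    (μ ν ρ σ : List (Fin n)) :
    ⟪((√((n : ℝ) ^ ((μ.length : ℤ) - ν.length)) : ℝ) : ℂ) • gnsVector ω (cuntzMonomial S ν μ),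
        ((√((n : ℝ) ^ ((ρ.length : ℤ) - σ.length)) : ℝ) : ℂ) •
          gnsVector ω (cuntzMonomial S σ ρ)⟫_ℂ =
      ⟪gnsVector ω (cuntzMonomial S ρ σ), gnsVector ω (cuntzMonomial S μ ν)⟫_ℂ := by
  simp only [inner_smul_left, inner_smul_right, Complex.conj_ofReal]
  by_cases hd : (μ.length : ℤ) - ν.length = (ρ.length : ℤ) - σ.length
  · have zpow_mul_zpow : (n : ℂ) ^ ((μ.length : ℤ) - ν.length) *
        (n : ℂ) ^ ((ν.length : ℤ) - μ.length) = 1 := by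
      rw [← neg_sub, ← zpow_neg_mul_zpow_self _ (Nat.cast_ne_zero.2 (zero_lt_one.trans hn).ne'),
        neg_sub]
    rw [← hd, ← mul_assoc, ← Complex.ofReal_mul, Real.mul_self_sqrt (by positivity),
      inner_gnsVector, inner_gnsVector, star_cuntzMonomial, star_cuntzMonomial,
      hω μ ν _ (cuntzMonomial_mem_cuntzCore S σ ρ), ← mul_assoc, Complex.ofReal_zpow,
      Complex.ofReal_natCast, zpow_mul_zpow, one_mul]
  · rw [hω.inner_gnsVector_eq_zero hn (by omega), hω.inner_gnsVector_eq_zero hn (Ne.symm hd)]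
    simp only [mul_zero]

theorem IsGaugeKMS.exists_isModularConjugation (hω : IsGaugeKMS S ω) (hS : IsCuntzAlgebra S)
    (hn : 1 < n) : ∃ J, IsModularConjugation S ω J := by
  obtain ⟨J, hJ⟩ := exists_antilinearIsometry
    (fun p q : List (Fin n) × List (Fin n) => hω.inner_sqrt_smul_gnsVector hn p.1 p.2 q.1 q.2)
    (hS.dense_span_gnsVector_cuntzMonomial ω)
  exact ⟨J, fun μ ν => hJ (μ, ν)⟩

namespace IsModularConjugation

variable {J : ω.GNS →ₛₗᵢ[starRingEnd ℂ] ω.GNS}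

theorem involutive (hJ : IsModularConjugation S ω J) (hS : IsCuntzAlgebra S) (hn : n ≠ 0) :
    Function.Involutive J := by
  suffices h : (J.comp J).toContinuousLinearMap = ContinuousLinearMap.id ℂ ω.GNS from
    DFunLike.congr_fun h
  refine ContinuousLinearMap.ext_on (hS.dense_span_gnsVector_cuntzMonomial ω) ?_
  rintro _ ⟨⟨μ, ν⟩, rfl⟩
  change J (J (gnsVector ω (cuntzMonomial S μ ν))) = gnsVector ω (cuntzMonomial S μ ν)
  rw [hJ, J.map_smulₛₗ, hJ, Complex.conj_ofReal, smul_smul, ← Complex.ofReal_mul,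
    ← Real.sqrt_mul (by positivity), ← zpow_add₀ (Nat.cast_ne_zero.2 hn), sub_add_sub_cancel,
    sub_self, zpow_zero, Real.sqrt_one, Complex.ofReal_one, one_smul]

theorem mem_preTomita_graph_iff (hJ : IsModularConjugation S ω J) (ξ η : ω.GNS) :
    (ξ, η) ∈ (preTomita S ω).graph ↔
      (ξ, J η) ∈ Submodule.span ℂ {p | ∃ μ ν : List (Fin n),
        p = (gnsVector ω (cuntzMonomial S μ ν),
          ((√((n : ℝ) ^ (-((μ.length : ℤ) - ν.length))) : ℝ) : ℂ) •
            gnsVector ω (cuntzMonomial S μ ν))} := by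
  let L : A →ₗ[ℂ] ω.GNS × ω.GNS := (gnsVectorCLM ω).toLinearMap.prod
    (J.toLinearMap.comp ((gnsVectorCLM ω).toLinearMap.comp (starLinearEquiv ℂ).toLinearMap))
  have L_cuntzMonomial (μ ν : List (Fin n)) : (gnsVector ω (cuntzMonomial S μ ν),
      ((√((n : ℝ) ^ (-((μ.length : ℤ) - ν.length))) : ℝ) : ℂ) •
        gnsVector ω (cuntzMonomial S μ ν)) = L (cuntzMonomial S μ ν) := by
    rw [neg_sub, ← hJ ν μ, ← star_cuntzMonomial S μ ν]
    rfl
  simp only [L_cuntzMonomial]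
  rw [← map_cuntzCore]
  refine exists_congr fun a => and_congr_right fun _ => ?_
  change (ξ, η) = (gnsVector ω a, gnsVector ω (star a)) ↔
    (gnsVector ω a, J (gnsVector ω (star a))) = (ξ, J η)
  rw [Prod.mk_inj, Prod.mk_inj, J.injective.eq_iff, eq_comm, @eq_comm _ η]

theorem isPolarDecomposition (hJ : IsModularConjugation S ω J) (hS : IsCuntzAlgebra S)
    (hn : n ≠ 0) (hV : IsInternalHilbertSum (homogeneousSubspace S ω)) :
    (preTomita S ω).closure.IsPolarDecomposition J
      (diagonalOperator (homogeneousSubspace S ω) fun k => ((√((n : ℝ) ^ (-k)) : ℝ) : ℂ)) where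
  involutive := hJ.involutive hS hn
  mem_graph_iff ξ η := by
    rw [diagonalOperator_homogeneousSubspace_graph hV]
    exact AntilinearRel.mem_closure_graph_iff (hJ.involutive hS hn) hJ.mem_preTomita_graph_iff ξ η

end IsModularConjugation

namespace IsGaugeKMS

variable (hω : IsGaugeKMS S ω) (hS : IsCuntzAlgebra S) (hn : 1 < n)

include hω hS hn

theorem modularOperator_eq :
    modularOperator S ω =
      diagonalOperator (homogeneousSubspace S ω) fun k => (((n : ℝ) ^ (-k) : ℝ) : ℂ) := by
  have hV := hω.isInternalHilbertSum hS hn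
  obtain ⟨J, hJ⟩ := hω.exists_isModularConjugation hS hn
  have sqrt_sq : (fun k : ℤ => ((√((n : ℝ) ^ (-k)) : ℝ) : ℂ)) ^ 2 =
      fun k : ℤ => (((n : ℝ) ^ (-k) : ℝ) : ℂ) := funext fun k => by
    rw [Pi.pow_apply, ← Complex.ofReal_pow, Real.sq_sqrt (by positivity)]
  have isSelfAdjoint_sqrt : IsSelfAdjoint fun k : ℤ => ((√((n : ℝ) ^ (-k)) : ℝ) : ℂ) :=
    funext fun k => Complex.conj_ofReal _
  refine LinearPMap.eq_of_eq_graph (SetLike.ext fun p => ?_)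
  rw [modularOperator, tomitaOperator,
    (hJ.isPolarDecomposition hS (zero_lt_one.trans hn).ne' hV).mem_adjoint_comp_self_graph_iff
      (diagonalOperator.isSelfAdjoint hV isSelfAdjoint_sqrt),
    diagonalOperator.exists_mem_graph_and_mem_graph_iff hV, sqrt_sq]

theorem modularOperator_gnsVector (μ ν : List (Fin n)) :
    ∃ hd : gnsVector ω (cuntzMonomial S μ ν) ∈ (modularOperator S ω).domain,
      modularOperator S ω ⟨gnsVector ω (cuntzMonomial S μ ν), hd⟩ =
        (n : ℂ) ^ ((ν.length : ℤ) - (μ.length : ℤ)) • gnsVector ω (cuntzMonomial S μ ν) := by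
  have hV := hω.isInternalHilbertSum hS hn
  have hmem := gnsVector_mem_homogeneousSubspace (S := S) (ω := ω) μ ν
  rw [hω.modularOperator_eq hS hn]
  refine ⟨diagonalOperator.mem_domain_of_mem hV hmem, ?_⟩
  rw [diagonalOperator.apply_of_mem hV hmem, Complex.ofReal_zpow, Complex.ofReal_natCast, neg_sub]

theorem isBorelFunctionOf_modularOperator {g : ℝ → ℂ} (hg : Measurable g) {f : ℤ → ℂ}
    (hf : ∀ k, g ((n : ℝ) ^ (-k)) = f k) :
    IsBorelFunctionOf (modularOperator S ω) g (diagonalOperator (homogeneousSubspace S ω) f) := by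
  rw [hω.modularOperator_eq hS hn, ← funext hf]
  exact isBorelFunctionOf_diagonalOperator (hω.isInternalHilbertSum hS hn) _ hg

theorem isBorelFunctionOf_modularOperator_cpow (t : ℝ) :
    IsBorelFunctionOf (modularOperator S ω) (fun x => (x : ℂ) ^ (Complex.I * t))
      (everywhereDefined
        (gaugeUnitary (hω.isInternalHilbertSum hS hn) (Circle.exp (-(t * Real.log n))))) := by
  rw [everywhereDefined_gaugeUnitary]
  refine hω.isBorelFunctionOf_modularOperator hS hn (by fun_prop) fun k => ?_
  rw [ofReal_zpow_cpow (by positivity), circleExp_zpow]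
  push_cast
  ring_nf

theorem isBorelFunctionOf_modularOperator_exp_log (t : ℝ) :
    IsBorelFunctionOf (modularOperator S ω)
      (fun x => Complex.exp (-(Complex.I * t / Real.log n) * Real.log x))
      (everywhereDefined (gaugeUnitary (hω.isInternalHilbertSum hS hn) (Circle.exp t))) := by
  have hlog : (Real.log n : ℂ) ≠ 0 :=
    Complex.ofReal_ne_zero.2 (Real.log_pos (by exact_mod_cast hn)).ne'
  rw [everywhereDefined_gaugeUnitary]
  refine hω.isBorelFunctionOf_modularOperator hS hn (by fun_prop) fun k => ?_
  rw [circleExp_zpow, Real.log_zpow, Int.cast_neg, Complex.ofReal_mul, Complex.ofReal_neg,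
    Complex.ofReal_intCast]
  congr 1
  field_simp

theorem isBorelFunctionOf_gaugeGenerator_exp_log :
    IsBorelFunctionOf (gaugeGenerator S ω) (fun x => Complex.exp (-(x * Real.log n)))
      (modularOperator S ω) := by
  have hV := hω.isInternalHilbertSum hS hn
  have zpow_neg_eq (k : ℤ) :
      (((n : ℝ) ^ (-k) : ℝ) : ℂ) = Complex.exp (-(((k : ℝ) : ℂ) * Real.log n)) := by
    rw [Complex.ofReal_zpow, Complex.ofReal_natCast,
      natCast_zpow_eq_exp (zero_lt_one.trans hn).ne']
    push_cast
    ring_nf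
  simp only [hω.modularOperator_eq hS hn, gaugeGenerator_eq hV, zpow_neg_eq]
  exact isBorelFunctionOf_diagonalOperator hV (fun k : ℤ => (k : ℝ))
    (g := fun x => Complex.exp (-(x * Real.log n))) (by fun_prop)

end IsGaugeKMS

theorem isBorelFunctionOf_gaugeGenerator_exp
    (hV : IsInternalHilbertSum (homogeneousSubspace S ω)) (t : ℝ) :
    IsBorelFunctionOf (gaugeGenerator S ω) (fun x => Complex.exp (Complex.I * t * x))
      (everywhereDefined (gaugeUnitary hV (Circle.exp t))) := by
  simp only [everywhereDefined_gaugeUnitary, gaugeGenerator_eq hV, circleExp_zpow,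
    ← Complex.ofReal_intCast]
  exact isBorelFunctionOf_diagonalOperator hV (fun k : ℤ => (k : ℝ))
    (g := fun x => Complex.exp (Complex.I * t * x)) (by fun_prop)

theorem gaugeUnitary_mul_cuntzMonomial_mul (hV : IsInternalHilbertSum (homogeneousSubspace S ω))
    (hS : IsCuntzAlgebra S) (hn : n ≠ 0) (t : ℝ) (μ ν : List (Fin n)) :
    gaugeUnitary hV (Circle.exp (-(t * Real.log n))) * ω.gnsStarAlgHom (cuntzMonomial S μ ν) *
        gaugeUnitary hV (Circle.exp (-(-t * Real.log n))) =
      (n : ℂ) ^ (Complex.I * t * ((ν.length : ℂ) - (μ.length : ℂ))) •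
        ω.gnsStarAlgHom (cuntzMonomial S μ ν) := by
  rw [neg_mul, Circle.exp_neg (-(t * Real.log n)), gaugeUnitary_mul_gnsStarAlgHom_mul hV hS,
    hS.gauge_cuntzMonomial, map_smul, circleExp_zpow,
    Complex.cpow_def_of_ne_zero (Nat.cast_ne_zero.2 hn), ← Complex.natCast_log]
  push_cast
  ring_nf

end Tomita

end

theorem lemma8p2 {n : ℕ} (hn : 2 ≤ n) {A : Type*} [CStarAlgebra A] [PartialOrder A]
    [StarOrderedRing A] (S : Fin n → A) (hS : IsCuntzAlgebra S)
    (τ : hS.fixedPoints →ₗ[ℂ] ℂ) (hτ : hS.IsFaithfulNormalizedTrace τ)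
    (ω : A →ₚ[ℂ] ℂ) (hω : ω = hS.kmsState τ hτ) :
    -- `a ↦ a^*` on `O_{nc}` is well defined on the GNS space and closable
    (preTomita S ω).closure.IsFunctional ∧
    -- polar decomposition of its closure: `S = J Δ^{1/2}` with `J` antiunitary, `J² = 1`
    (∃ (J : ω.GNS →ₛₗᵢ[starRingEnd ℂ] ω.GNS) (Q : ω.GNS →ₗ.[ℂ] ω.GNS),
      (∀ ξ, J (J ξ) = ξ) ∧
      IsBorelFunctionOf (modularOperator S ω) (fun x => (√x : ℂ)) Q ∧
      (∀ ξ, ξ ∈ (tomitaOperator S ω).domain ↔ ξ ∈ Q.domain) ∧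
      ∀ (ξ : (tomitaOperator S ω).domain) (η : Q.domain), (ξ : ω.GNS) = η →
        tomitaOperator S ω ξ = J (Q η)) ∧
    -- `Δ (S_μ S_ν^*) = n^{|ν| - |μ|} S_μ S_ν^*`
    (∀ μ ν : List (Fin n),
      ∃ hd : gnsVector ω (cuntzMonomial S μ ν) ∈ (modularOperator S ω).domain,
        modularOperator S ω ⟨gnsVector ω (cuntzMonomial S μ ν), hd⟩ =
          (n : ℂ) ^ ((ν.length : ℤ) - (μ.length : ℤ)) • gnsVector ω (cuntzMonomial S μ ν)) ∧
    -- `σ_t (S_μ S_ν^*) = Δ^{it} S_μ S_ν^* Δ^{-it} = n^{it(|ν| - |μ|)} S_μ S_ν^*`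
    (∃ U : ℝ → ω.GNS →L[ℂ] ω.GNS,
      (∀ t : ℝ, IsBorelFunctionOf (modularOperator S ω)
        (fun x => (x : ℂ) ^ (Complex.I * t)) (everywhereDefined (U t))) ∧
      ∀ (t : ℝ) (μ ν : List (Fin n)),
        U t * ω.gnsStarAlgHom (cuntzMonomial S μ ν) * U (-t) =
          (n : ℂ) ^ (Complex.I * t * ((ν.length : ℂ) - (μ.length : ℂ))) •
            ω.gnsStarAlgHom (cuntzMonomial S μ ν)) ∧
    -- `Δ = e^{-D log n}`
    IsBorelFunctionOf (gaugeGenerator S ω)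
      (fun x => Complex.exp (-(x * Real.log n))) (modularOperator S ω) ∧
    -- `e^{itD} = e^{-(it / log n) log Δ}`, and this unitary implements the gauge action
    ∃ V : ℝ → ω.GNS →L[ℂ] ω.GNS,
      (∀ t : ℝ, IsBorelFunctionOf (gaugeGenerator S ω)
        (fun x => Complex.exp (Complex.I * t * x)) (everywhereDefined (V t))) ∧
      (∀ t : ℝ, IsBorelFunctionOf (modularOperator S ω)
        (fun x => Complex.exp (-(Complex.I * t / Real.log n) * Real.log x))
        (everywhereDefined (V t))) ∧
      ∀ (t : ℝ) (a : A), V t (gnsVector ω a) = gnsVector ω (hS.gauge (Circle.exp t) a) := by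
  subst hω
  have hω := hS.isGaugeKMS_kmsState hτ
  have hV := hω.isInternalHilbertSum hS hn
  have hn0 : n ≠ 0 := (zero_lt_two.trans_le hn).ne'
  obtain ⟨J, hJ⟩ := hω.exists_isModularConjugation hS hn
  have polar := hJ.isPolarDecomposition hS hn0 hV
  exact ⟨polar.isFunctional,
    ⟨J, _, polar.involutive,
      hω.isBorelFunctionOf_modularOperator hS hn (by fun_prop) fun _ => rfl,
      fun _ => polar.mem_domain_iff, polar.toOperator_apply_eq⟩,
    hω.modularOperator_gnsVector hS hn,
    ⟨fun t => gaugeUnitary hV (Circle.exp (-(t * Real.log n))),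
      hω.isBorelFunctionOf_modularOperator_cpow hS hn,
      gaugeUnitary_mul_cuntzMonomial_mul hV hS hn0⟩,
    hω.isBorelFunctionOf_gaugeGenerator_exp_log hS hn,
    ⟨fun t => gaugeUnitary hV (Circle.exp t),
      isBorelFunctionOf_gaugeGenerator_exp hV,
      hω.isBorelFunctionOf_modularOperator_exp_log hS hn,
      fun _ a => gaugeUnitary_gnsVector hV hS _ a⟩⟩
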